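/- Setting. Let $(\Gamma,d)$ be a countable metric space. For $X\subset\Gamma$ and $r\ge 0$ put $X(r)=\{y\in\Gamma: d(y,x)\le r\text{ for some }x\in X\}$. A non-increasing $F:[0,\infty)\to(0,\infty)$ is an $F$-function if $\sup_{x}\sum_{y}F(d(x,y))<\infty$ and there is $C>0$ with $\sum_{z}F(d(x,z))F(d(z,y))\le C\,F(d(x,y))$ for all $x,y\in\Gamma$; $C_F$ denotes the infimum of such $C$. Put $G(r)=\sup_{x\in\Gamma}\sum_{y:\,d(x,y)>r}F(d(x,y))$ and $\mathscr E_t(k)=\sum_{n\ge\lceil k\rceil}t^n/n!$. To each $x\in\Gamma$ attach a finite-dimensional Hilbert space $\mathcal H_x$, and for finite $\Lambda\subset\Gamma$ let $\mathcal A_\Lambda=\mathcal B\big(\bigotimes_{x\in\Lambda}\mathcal H_x\big)$ with the operator norm; for $X\subset\Lambda$, elements of $\mathcal A_X$ and linear maps on $\mathcal A_X$ act on $\Lambda$ after tensoring with the identity. For a linear map $\Phi$ on $\mathcal A_X$ let $\|\Phi\|_{cb}=\sup_n\|\Phi\otimes \mathrm{id}_{M_n}\|$, and let $CB_0(X)$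 be the set of completely bounded $\Phi$ on $\mathcal A_X$ with $\Phi(\mathbb 1)=0$. A dissipative interaction is a family $\mathscr L=\{L_Z\}$, indexed by the finite $Z\subset\Gamma$, of linear maps $L_Z:\mathcal A_Z\to\mathcal A_Z$ in Lindblad form $$L_Z(A)=i[H_Z,A]+\sum_{j=1}^{\ell_Z}\Big(K_j^*AK_j-\tfrac12\{K_j^*K_j,A\}\Big),\qquad H_Z=H_Z^*\in\mathcal A_Z,\ K_j\in\mathcal A_Z .$$ Its $F$-norm $\|\mathscr L\|_F$ is the infimum of all $M\ge0$ such that $\sum_{Z\ni x,y}\|L_Z\|_{cb}\le M\,F(d(x,y))$ for all $x,y\in\Gamma$. For finite $\Lambda$, $R>0$ and $t\ge 0$ let $$T^\Lambda_t=\exp\Big(t\sum_{Z\subset\Lambda}L_Z\Big),\qquad T^{\Lambda,R}_t=\exp\Big(t\sum_{Z\subset\Lambda,\ \mathrm{diam}(Z)\le R}L_Z\Big).$$ Theorem. Let $F$ be an $F$-function on $(\Gamma,d)$ and $\mathscr L$ a dissipative interaction with $\|\mathscr L\|_F<\infty$; put $v=\|\mathscr L\|_FC_F$. Let $X,Y\subset\Gamma$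 be finite and disjoint, $\Lambda\subset\Gamma$ finite with $X\cup Y\subset\Lambda$, $A\in\mathcal A_X$ and $K\in CB_0(Y)$. For $t\ge0$, $r\ge0$, $R>0$ let $$E(t,r,R)=\|\mathscr L\|_F\,G(R/2)\Big(t\,|X(r)|+\frac{\mathscr E_{vt}(1+r/R)}{v\,C_F}\sum_{x\in X}\sum_{y\in\Lambda\setminus X(r)}F(d(x,y))\Big)$$ (read as $0$ if $\|\mathscr L\|_F=0$). (i) For all $t\ge0$, $r\ge0$ and $R>0$, $$\|K(T^\Lambda_t(A))\|\le\|K(T^{\Lambda,R}_t(A))\|+\|K\|_{cb}\,\|A\|\,E(t,r,R).$$ (ii) Suppose moreover that $(\Gamma,d)$ is $\nu$-regular, i.e. for some $\kappa,\nu>0$ every closed ball satisfies $|b_x(n+1)|\le\kappa(n+1)^\nu$ for all $x\in\Gamma$ and integers $n\ge0$, and that $\sum_{n\ge0}(1+n)^\nu F(n)<\infty$. Then for all $t\ge0$ and $r\ge0$, $E(t,r,R)\to0$ as $R\to\infty$, and the bound (i) recovers in this limit the Nachtergaele–Vershynina–Zagrebnov bound: $$\limsup_{R\to\infty}\Big(\|K(T^{\Lambda,R}_t(A))\|+\|K\|_{cb}\|A\|E(t,r,R)\Big)\le\frac{\|K\|_{cb}\|A\|}{C_F}\big(e^{vt}-1\big)\sum_{x\in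 X}\sum_{y\in Y}F(d(x,y)),$$ and hence $$\|K(T^\Lambda_t(A))\|\le\frac{\|K\|_{cb}\|A\|}{C_F}\big(e^{vt}-1\big)\sum_{x\in X}\sum_{y\in Y}F(d(x,y)).$$ -/

import Mathlib

open scoped ENNReal Matrix.Norms.L2Operator

/-! ### Completely bounded maps between matrix algebras -/

/-- The ampliation `Φ ⊗ 𝟙` of a linear map `Φ` on a full matrix algebra: an element of
`M_I(ℂ) ⊗ M_m(ℂ)` is regarded as an `m × m` block matrix with blocks in `M_I(ℂ)`, and `Φ` is
applied to every block. -/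
def ampliation {I : Type*} (m : Type*) (Φ : Matrix I I ℂ →ₗ[ℂ] Matrix I I ℂ) :
    Matrix (I × m) (I × m) ℂ →ₗ[ℂ] Matrix (I × m) (I × m) ℂ where
  toFun B := Matrix.of fun p q => Φ (Matrix.of fun i j => B (i, p.2) (j, q.2)) p.1 q.1
  map_add' B C := by
    ext p q
    exact congrFun (congrFun (Φ.map_add (Matrix.of fun i j => B (i, p.2) (j, q.2))
      (Matrix.of fun i j => C (i, p.2) (j, q.2))) p.1) q.1
  map_smul' c B := by
    ext p q
    exact congrFun (congrFun (Φ.map_smul c (Matrix.of fun i j => B (i, p.2) (j, q.2))) p.1) q.1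

/-- The completely bounded norm `‖Φ‖_cb = sup_n ‖Φ ⊗ 𝟙_{n × n}‖`, an extended nonnegative number.
All matrix algebras carry the operator norm of the Euclidean (Hilbert) space they act on. -/
noncomputable def cbNorm {I : Type*} [Fintype I] [DecidableEq I]
    (Φ : Matrix I I ℂ →ₗ[ℂ] Matrix I I ℂ) : ℝ≥0∞ :=
  ⨆ n : ℕ, ‖LinearMap.toContinuousLinearMap (ampliation (Fin n) Φ)‖ₑ

/-- Completely bounded maps that annihilate the identity. -/
def IsCB0 {I : Type*} [Fintype I] [DecidableEq I]
    (Φ : Matrix I I ℂ →ₗ[ℂ] Matrix I I ℂ) : Prop :=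
  cbNorm Φ < ∞ ∧ Φ 1 = 0

/-- A linear map in Lindblad form:
`A ↦ i[H, A] + ∑ⱼ (Kⱼ* A Kⱼ - ½ {Kⱼ* Kⱼ, A})` with `H` self-adjoint. -/
def IsLindblad {I : Type*} [Fintype I] [DecidableEq I]
    (Φ : Matrix I I ℂ →ₗ[ℂ] Matrix I I ℂ) : Prop :=
  ∃ (H : Matrix I I ℂ) (l : ℕ) (K : Fin l → Matrix I I ℂ), IsSelfAdjoint H ∧
    ∀ A : Matrix I I ℂ, Φ A = Complex.I • (H * A - A * H) +
      ∑ j, (star (K j) * A * K j -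
        (1 / 2 : ℂ) • (star (K j) * K j * A + A * (star (K j) * K j)))

/-! ### Quantum spin systems

The one-site Hilbert space at `x` is `ℂ^(ι x)` with `ι x` a finite type, so that the Hilbert space
of a finite volume `Λ`, the tensor product of the one-site spaces, is `ℂ^(Config ι Λ)`. -/

/-- Labels of the product basis of `⨂_{x ∈ Λ} ℂ^(ι x)`. -/
abbrev Config {Γ : Type*} (ι : Γ → Type*) (Λ : Finset Γ) : Type _ := ∀ x : {x // x ∈ Λ}, ι x

/-- The algebra of observables `𝒜_Λ`: all operators on `⨂_{x ∈ Λ} ℂ^(ι x)`. -/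
abbrev LocalAlg {Γ : Type*} (ι : Γ → Type*) (Λ : Finset Γ) : Type _ :=
  Matrix (Config ι Λ) (Config ι Λ) ℂ

/-- The identification `ℋ_Λ = ℋ_X ⊗ ℋ_{Λ ∖ X}` for `X ⊆ Λ`, on basis labels. -/
def splitConfig {Γ : Type*} [DecidableEq Γ] (ι : Γ → Type*) {X Λ : Finset Γ} (h : X ⊆ Λ) :
    Config ι Λ ≃ Config ι X × Config ι (Λ \ X) where
  toFun σ := (fun x => σ ⟨x, h x.2⟩, fun x => σ ⟨x, (Finset.mem_sdiff.1 x.2).1⟩)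
  invFun p := fun x =>
    if hx : (x : Γ) ∈ X then p.1 ⟨x, hx⟩ else p.2 ⟨x, Finset.mem_sdiff.2 ⟨x.2, hx⟩⟩
  left_inv σ := by
    funext x
    by_cases hx : (x : Γ) ∈ X <;> simp [hx]
  right_inv p := by
    refine Prod.ext (funext fun x => ?_) (funext fun x => ?_)
    · simp
    · simp [(Finset.mem_sdiff.1 x.2).2]

section Spin

variable {Γ : Type*} [DecidableEq Γ] {ι : Γ → Type*} [∀ x, Fintype (ι x)]
  [∀ x, DecidableEq (ι x)]

/-- The inclusion `𝒜_X ⊆ 𝒜_Λ`, `A ↦ A ⊗ 𝟙_{Λ ∖ X}`. -/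
noncomputable def embed {X Λ : Finset Γ} (h : X ⊆ Λ) (A : LocalAlg ι X) : LocalAlg ι Λ :=
  (Matrix.kroneckerMap (· * ·) A (1 : LocalAlg ι (Λ \ X))).submatrix
    (splitConfig ι h) (splitConfig ι h)

/-- The extension `Φ ⊗ id_{Λ ∖ X}` to `𝒜_Λ` of a linear map `Φ` on `𝒜_X`. -/
noncomputable def extend {X Λ : Finset Γ} (h : X ⊆ Λ) (Φ : LocalAlg ι X →ₗ[ℂ] LocalAlg ι X) :
    LocalAlg ι Λ →ₗ[ℂ] LocalAlg ι Λ :=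
  let e := Matrix.reindexLinearEquiv ℂ ℂ (splitConfig ι h) (splitConfig ι h)
  e.symm.toLinearMap ∘ₗ ampliation (Config ι (Λ \ X)) Φ ∘ₗ e.toLinearMap

/-- The finite-volume generator `𝓛^Λ = ∑_{Z ⊆ Λ} L_Z`. -/
noncomputable def generator (L : ∀ Z : Finset Γ, LocalAlg ι Z →ₗ[ℂ] LocalAlg ι Z)
    (Λ : Finset Γ) : LocalAlg ι Λ →ₗ[ℂ] LocalAlg ι Λ :=
  ∑ Z ∈ Λ.powerset.attach, extend (Finset.mem_powerset.1 Z.2) (L Z)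

/-- The finite-range generator `𝓛^{Λ,R}`, the sum of `L_Z` over `Z ⊆ Λ` with `diam Z ≤ R`. -/
noncomputable def generatorRange [MetricSpace Γ]
    (L : ∀ Z : Finset Γ, LocalAlg ι Z →ₗ[ℂ] LocalAlg ι Z)
    (Λ : Finset Γ) (R : ℝ) : LocalAlg ι Λ →ₗ[ℂ] LocalAlg ι Λ :=
  ∑ Z ∈ Λ.powerset.attach.filter (fun Z => Metric.diam (Z.1 : Set Γ) ≤ R),
    extend (Finset.mem_powerset.1 Z.2) (L Z)

/-- The semigroup `exp(t 𝓛)` on `𝒜_Λ`. -/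
noncomputable def semigroup {Λ : Finset Γ} (𝓛 : LocalAlg ι Λ →ₗ[ℂ] LocalAlg ι Λ) (t : ℝ) :
    LocalAlg ι Λ →L[ℂ] LocalAlg ι Λ :=
  NormedSpace.exp ((t : ℂ) • LinearMap.toContinuousLinearMap 𝓛)

/-- The dynamics `T_t^Λ = exp(t 𝓛^Λ)`. -/
noncomputable def dynamics (L : ∀ Z : Finset Γ, LocalAlg ι Z →ₗ[ℂ] LocalAlg ι Z)
    (Λ : Finset Γ) (t : ℝ) : LocalAlg ι Λ →L[ℂ] LocalAlg ι Λ :=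
  semigroup (generator L Λ) t

/-- The finite-range dynamics `T_t^{Λ,R} = exp(t 𝓛^{Λ,R})`. -/
noncomputable def dynamicsRange [MetricSpace Γ]
    (L : ∀ Z : Finset Γ, LocalAlg ι Z →ₗ[ℂ] LocalAlg ι Z)
    (Λ : Finset Γ) (R t : ℝ) : LocalAlg ι Λ →L[ℂ] LocalAlg ι Λ :=
  semigroup (generatorRange L Λ R) t

/-- The `F`-norm of an interaction: the infimum of all `M ∈ [0, ∞]` such that
`∑_{Z ∋ x, y} ‖L_Z‖_cb ≤ M F(d(x,y))` for all sites `x, y`. -/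
noncomputable def fNorm [MetricSpace Γ] (F : ℝ → ℝ)
    (L : ∀ Z : Finset Γ, LocalAlg ι Z →ₗ[ℂ] LocalAlg ι Z) : ℝ≥0∞ :=
  sInf {M : ℝ≥0∞ | ∀ x y : Γ,
    ∑' Z : {Z : Finset Γ // x ∈ Z ∧ y ∈ Z}, cbNorm (L Z) ≤ M * ENNReal.ofReal (F (dist x y))}

end Spin

/-! ### Decay functions -/

/-- `F` (only its values on `[0, ∞)` matter) is an `F`-function on the metric space `Γ`. -/
structure IsFFunction (Γ : Type*) [MetricSpace Γ] (F : ℝ → ℝ) : Prop where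
  antitone : AntitoneOn F (Set.Ici 0)
  pos : ∀ r, 0 ≤ r → 0 < F r
  summable : ∀ x : Γ, Summable fun y : Γ => F (dist x y)
  bddAbove : BddAbove (Set.range fun x : Γ => ∑' y : Γ, F (dist x y))
  convolution : ∃ C : ℝ, 0 < C ∧ ∀ x y : Γ,
    (Summable fun z : Γ => F (dist x z) * F (dist z y)) ∧
      ∑' z : Γ, F (dist x z) * F (dist z y) ≤ C * F (dist x y)

/-- The convolution constant `C_F`: the infimum of all admissible `C > 0`. -/
noncomputable def convConst (Γ : Type*) [MetricSpace Γ] (F : ℝ → ℝ) : ℝ :=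
  sInf {C : ℝ | 0 < C ∧ ∀ x y : Γ,
    ∑' z : Γ, F (dist x z) * F (dist z y) ≤ C * F (dist x y)}

/-- `G(r) = sup_x ∑_{y : d(x,y) > r} F(d(x,y))`. -/
noncomputable def tailSup (Γ : Type*) [MetricSpace Γ] (F : ℝ → ℝ) (r : ℝ) : ℝ :=
  ⨆ x : Γ, ∑' y : {y : Γ // r < dist x y}, F (dist x y)

/-- `Γ` is `ν`-regular with constant `κ`: `|b_x(n+1)| ≤ κ (n+1)^ν` for all `x` and `n ≥ 0`. -/
def IsRegularSpace (Γ : Type*) [MetricSpace Γ] (κ ν : ℝ) : Prop :=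
  0 < κ ∧ 0 < ν ∧ ∀ (x : Γ) (n : ℕ), (Metric.closedBall x ((n : ℝ) + 1)).Finite ∧
    ((Metric.closedBall x ((n : ℝ) + 1)).ncard : ℝ) ≤ κ * ((n : ℝ) + 1) ^ ν

/-- The tail `ℰ_t(k) = ∑_{n ≥ ⌈k⌉} t^n / n!` of the exponential series. -/
noncomputable def expTail (t k : ℝ) : ℝ :=
  ∑' n : ℕ, t ^ (n + ⌈k⌉₊) / ((n + ⌈k⌉₊).factorial : ℝ)

/-- The inflation `X(r) = {y : d(y,x) ≤ r for some x ∈ X}`. -/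
def inflation {Γ : Type*} [MetricSpace Γ] (X : Finset Γ) (r : ℝ) : Set Γ :=
  {y | ∃ x ∈ X, dist y x ≤ r}

open scoped Classical in
/-- With `M = ‖𝓛‖_F` and `v = M C_F`, the quantity
`M G(R/2) (t |X(r)| + ℰ_{vt}(1 + r/R) / (v C_F) ∑_{x ∈ X} ∑_{y ∈ Λ ∖ X(r)} F(d(x,y)))`.
For `M = 0` it is `0`. -/
noncomputable def rangeError {Γ : Type*} [MetricSpace Γ] (F : ℝ → ℝ) (M : ℝ)
    (X Λ : Finset Γ) (t r R : ℝ) : ℝ :=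
  let C := convConst Γ F
  let v := M * C
  M * tailSup Γ F (R / 2) *
    (t * ((inflation X r).ncard : ℝ) +
      expTail (v * t) (1 + r / R) / (v * C) *
        ∑ x ∈ X, ∑ y ∈ Λ with y ∉ inflation X r, F (dist x y))

/-! Two properties of a Lindblad generator carry the proof. It generates contractions, even after
tensoring with an identity (`IsLindblad.isDissipative_extend`), and it annihilates `1`, so `L_Z`
kills every observable supported off `Z` (`extend_embed_eq_zero`).

Lieb-Robinson bound: `K` on `Y` commutes with all terms whose support misses `Y`. By Duhamel, `K(T_t
A)` is therefore controlled by `K(A)`, which vanishes when `X` and `Y` are disjoint, and by the time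
integral of `K(L_Z(T_s A))` over the sets `Z` meeting `Y`. Each such `L_Z` again annihilates `1`, so
the step repeats with `L_Z` in the role of `K`. Order `n` contributes `t^n/n!` times the weight of
the chains of `n` sets leading from `Y` to `X` (`norm_extend_exp_embed_le`). The `F`-norm and the
convolution inequality bound that weight by `M^n C_F^(n-1) ∑ F(d(x,y))` (`chainWeight_succ_le`). If
all sets have diameter at most `R`, chains across a distance `r` need at least `r/R` links, and only
a tail of the exponential series remains.

Truncation: Duhamel between the two dynamics leaves the terms of diameter greater than `R`, applied
to the observable evolved with finite range (`sum_norm_localTerm_le`). Those meeting `X(r)` are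
bounded by contractivity; those further away gain the tail from `⌈r/R⌉`. Integration in time raises
the tail index by one, which produces `1 + r/R`.

For (ii), regularity forces `G(R/2) → 0`, while the truncated dynamics equals the full one once `R ≥
diam Λ`. The limit is thus bounded by the untruncated Lieb-Robinson estimate. -/

/-! ### Contraction semigroups and Duhamel comparison -/

section Semigroups

open Filter Set Topology

variable {E : Type*} [NormedAddCommGroup E] [NormedSpace ℂ E]

/-- `‖v + ε a v‖ ≤ (1 + O(ε²)) ‖v‖` for `ε > 0`: a convenient form of dissipativity of a bounded
generator, from which `exp (t a)` is a contraction for `t ≥ 0`. -/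
def IsDissipative (a : E →L[ℂ] E) : Prop :=
  ∃ c : ℝ, ∀ ε : ℝ, 0 < ε → ∀ v : E, ‖v + (ε : ℂ) • a v‖ ≤ (1 + c * ε ^ 2) * ‖v‖

theorem IsDissipative.zero : IsDissipative (0 : E →L[ℂ] E) :=
  ⟨0, fun ε _ v => by simp⟩

/-- A step of length `ε` along `a + b` is the average of steps of length `2ε` along `a` and along
`b`. Sums of generators are thus handled without a product formula. -/
theorem IsDissipative.add {a b : E →L[ℂ] E} (ha : IsDissipative a) (hb : IsDissipative b) :
    IsDissipative (a + b) := by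
  obtain ⟨c, hc⟩ := ha
  obtain ⟨d, hd⟩ := hb
  refine ⟨2 * (c + d), fun ε hε v => ?_⟩
  have h1 := hc (2 * ε) (by positivity) v
  have h2 := hd (2 * ε) (by positivity) v
  have key : v + (ε : ℂ) • (a + b) v =
      (1 / 2 : ℂ) • ((v + ((2 * ε : ℝ) : ℂ) • a v) + (v + ((2 * ε : ℝ) : ℂ) • b v)) := by
    rw [add_apply]
    push_cast
    module
  rw [key, norm_smul]
  have h3 := norm_add_le (v + ((2 * ε : ℝ) : ℂ) • a v) (v + ((2 * ε : ℝ) : ℂ) • b v)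
  have h4 : ‖(1 / 2 : ℂ)‖ = 1 / 2 := by norm_num
  rw [h4]
  nlinarith

theorem IsDissipative.sum {α : Type*} (s : Finset α) {a : α → E →L[ℂ] E}
    (h : ∀ i ∈ s, IsDissipative (a i)) : IsDissipative (∑ i ∈ s, a i) := by
  classical
  induction s using Finset.induction_on with
  | empty => simpa using IsDissipative.zero
  | insert i s hi ih =>
    rw [Finset.sum_insert hi]
    exact (h i (Finset.mem_insert_self i s)).add
      (ih fun j hj => h j (Finset.mem_insert_of_mem hj))

variable [CompleteSpace E]

theorem hasDerivAt_exp_ofReal_smul (a : E →L[ℂ] E) (t : ℝ) :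
    HasDerivAt (fun s : ℝ => NormedSpace.exp ((s : ℂ) • a))
      (a * NormedSpace.exp ((t : ℂ) • a)) t  := by
  simpa [Function.comp_def] using
    (hasDerivAt_exp_smul_const' a (t : ℂ)).scomp t Complex.ofRealCLM.hasDerivAt

theorem hasDerivAt_exp_ofReal_smul_apply (a : E →L[ℂ] E) (v : E) (t : ℝ) :
    HasDerivAt (fun s : ℝ => NormedSpace.exp ((s : ℂ) • a) v)
      (a (NormedSpace.exp ((t : ℂ) • a) v)) t := by
  have h := ((ContinuousLinearMap.apply ℂ E v).restrictScalars ℝ).hasFDerivAt.comp_hasDerivAt t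
    (hasDerivAt_exp_ofReal_smul a t)
  exact h

/-- The semigroup generated by a dissipative operator is contractive. -/
theorem IsDissipative.norm_exp_apply_le {a : E →L[ℂ] E} (ha : IsDissipative a) {t : ℝ}
    (ht : 0 ≤ t) (v : E) : ‖NormedSpace.exp ((t : ℂ) • a) v‖ ≤ ‖v‖ := by
  obtain ⟨c, hc⟩ := ha
  have hd := hasDerivAt_exp_ofReal_smul_apply a v
  set f : ℝ → E := fun s => NormedSpace.exp ((s : ℂ) • a) v with hf
  have hcont : Continuous fun s => ‖f s‖ :=
    continuous_norm.comp (continuous_iff_continuousAt.2 fun s => (hd s).continuousAt)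
  refine image_le_of_liminf_slope_right_le_deriv_boundary (f := fun s => ‖f s‖) (a := 0) (b := t)
    (B := fun _ => ‖v‖) (B' := fun _ => 0) hcont.continuousOn (by simp [hf])
    continuousOn_const (fun x _ => hasDerivWithinAt_const _ _ _) ?_ (right_mem_Icc.2 ht)
  -- The norm need not be differentiable, so only upper right slopes are estimated. Near `x` the
  -- orbit is an Euler step plus `o(z - x)`; dissipativity lets the step grow by at most `O((z -
  -- x)²)`. Each error receives half of `r`.
  intro x _ r hr
  refine Eventually.frequently ?_
  have hx := hd x
  have hlo := (hasDerivAt_iff_isLittleO.1 hx).def (half_pos hr)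
  have hsmall : ∀ᶠ z in 𝓝 x, c * (z - x) * ‖f x‖ < r / 2 := by
    have : Tendsto (fun z : ℝ => c * (z - x) * ‖f x‖) (𝓝 x) (𝓝 (c * (x - x) * ‖f x‖)) :=
      Continuous.tendsto (by fun_prop) x
    refine this.eventually_lt_const ?_
    simpa using hr
  filter_upwards [nhdsWithin_le_nhds hlo, nhdsWithin_le_nhds hsmall, self_mem_nhdsWithin]
    with z hz1 hz2 hz3
  have hpos : 0 < z - x := sub_pos.2 hz3
  rw [slope_def_field, div_lt_iff₀ hpos]
  have h1 := hc (z - x) hpos (f x)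
  have h2 : f z = (f x + ((z - x : ℝ) : ℂ) • a (f x)) + (f z - f x - (z - x) • a (f x)) := by
    rw [Complex.coe_smul]
    abel
  have h3 : ‖f z‖ ≤ ‖f x + ((z - x : ℝ) : ℂ) • a (f x)‖ + ‖f z - f x - (z - x) • a (f x)‖ := by
    conv_lhs => rw [h2]
    exact norm_add_le _ _
  have hz1' : ‖f z - f x - (z - x) • a (f x)‖ ≤ r / 2 * ‖z - x‖ := hz1
  rw [Real.norm_of_nonneg hpos.le] at hz1'
  have h5 := mul_lt_mul_of_pos_right hz2 hpos
  nlinarith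

/-- Duhamel comparison of `k ∘ exp (t a)` with `exp (t b) ∘ k`. -/
theorem norm_intertwine_exp_sub_le {a b k : E →L[ℂ] E}
    (hb : ∀ s : ℝ, 0 ≤ s → ∀ w, ‖NormedSpace.exp ((s : ℂ) • b) w‖ ≤ ‖w‖) (v : E)
    {B B' : ℝ → ℝ} (h0 : B 0 = 0) (hB : ∀ s, HasDerivAt B (B' s) s)
    (hbound : ∀ s : ℝ, 0 ≤ s → ‖k (a (NormedSpace.exp ((s : ℂ) • a) v)) -
      b (k (NormedSpace.exp ((s : ℂ) • a) v))‖ ≤ B' s) {t : ℝ} (ht : 0 ≤ t) :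
    ‖k (NormedSpace.exp ((t : ℂ) • a) v) - NormedSpace.exp ((t : ℂ) • b) (k v)‖ ≤ B t := by
  set w : ℝ → E := fun s => NormedSpace.exp ((s : ℂ) • a) v with hw
  set U : ℝ → E →L[ℂ] E := fun s => NormedSpace.exp ((s : ℂ) • b) with hU
  -- Interpolation `s ↦ U (t - s) (k (w s))`, shifted to vanish at `s = 0`. Its derivative is `U (t
  -- - s)` applied to the intertwining defect, and contractivity removes `U`. An explicit primitive
  -- `B` replaces the integral.
  have hder : ∀ s, HasDerivAt (fun s => U (t - s) (k (w s)) - U t (k v))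
      (U (t - s) (k (a (w s)) - b (k (w s)))) s := by
    intro s
    have h1 : HasDerivAt (fun s => U (t - s)) (-(U (t - s) * b)) s := by
      have := (hasDerivAt_exp_ofReal_smul b (t - s)).scomp s ((hasDerivAt_id s).const_sub t)
      have hcomm : U (t - s) * b = b * U (t - s) :=
        ((Commute.refl b).smul_right ((t - s : ℝ) : ℂ)).exp_right.eq.symm
      rw [hcomm]
      simpa [hU, Function.comp_def, -Complex.ofReal_sub] using this
    have h2 : HasDerivAt (fun s => k (w s)) (k (a (w s))) s :=
      (k.restrictScalars ℝ).hasFDerivAt.comp_hasDerivAt s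
        (hasDerivAt_exp_ofReal_smul_apply a v s)
    have h3 : HasDerivAt (fun s => U (t - s) (k (w s)))
        ((-(U (t - s) * b)) (k (w s)) + U (t - s) (k (a (w s)))) s := by
      have h4 : HasDerivAt (fun s => (U (t - s)).restrictScalars ℝ)
          ((-(U (t - s) * b)).restrictScalars ℝ) s :=
        (ContinuousLinearMap.restrictScalarsL ℂ E E ℝ ℝ).hasFDerivAt.comp_hasDerivAt s h1
      exact h4.clm_apply h2
    convert (h3.sub_const (U t (k v))) using 1
    rw [map_sub]
    simp [sub_eq_neg_add]
  have key := image_norm_le_of_norm_deriv_right_le_deriv_boundary (a := 0) (b := t)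
    (f := fun s => U (t - s) (k (w s)) - U t (k v))
    (fun s _ => (hder s).continuousAt.continuousWithinAt)
    (fun s _ => (hder s).hasDerivWithinAt) (B := B) (B' := B') (by simp [hw, hU, h0]) hB
    (fun s hs => (hb _ (sub_nonneg.2 hs.2.le) _).trans (hbound s hs.1))
    (right_mem_Icc.2 ht)
  simpa [hU, hw] using key

end Semigroups

/-! ### Tails of the exponential series -/

section ExpTail

open Finset

theorem expTail_eq (t k : ℝ) :
    expTail t k = Real.exp t - ∑ n ∈ range ⌈k⌉₊, t ^ n / (n.factorial : ℝ) := by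
  have hs : Summable fun n : ℕ => t ^ n / (n.factorial : ℝ) := Real.summable_pow_div_factorial t
  have h := hs.sum_add_tsum_nat_add ⌈k⌉₊
  have he : Real.exp t = ∑' n : ℕ, t ^ n / (n.factorial : ℝ) := by
    rw [Real.exp_eq_exp_ℝ, NormedSpace.exp_eq_tsum_div]
  rw [expTail, he, ← h]
  ring

theorem hasDerivAt_pow_div_factorial (N : ℕ) (t : ℝ) :
    HasDerivAt (fun t : ℝ => t ^ (N + 1) / ((N + 1).factorial : ℝ))
      (t ^ N / (N.factorial : ℝ)) t := by
  convert! (hasDerivAt_pow (N + 1) t).div_const ((N + 1).factorial : ℝ) using 1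
  rw [Nat.factorial_succ]
  push_cast
  field_simp

theorem hasDerivAt_sum_pow_div_factorial (N : ℕ) (t : ℝ) :
    HasDerivAt (fun t : ℝ => ∑ n ∈ range (N + 1), t ^ n / (n.factorial : ℝ))
      (∑ n ∈ range N, t ^ n / (n.factorial : ℝ)) t := by
  induction N with
  | zero => simpa using hasDerivAt_const t (1 : ℝ)
  | succ N ih =>
    have h2 := ih.add (hasDerivAt_pow_div_factorial N t)
    rw [sum_range_succ]
    refine h2.congr_of_eventuallyEq (Filter.Eventually.of_forall fun x => ?_)
    simp [sum_range_succ _ (N + 1)]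

/-- Differentiation shifts the series by one index. Nonnegativity of `k` is needed because the
ceiling is taken in `ℕ`, where it truncates at zero. -/
theorem hasDerivAt_expTail {k : ℝ} (hk : 0 ≤ k) (t : ℝ) :
    HasDerivAt (fun t => expTail t (1 + k)) (expTail t k) t := by
  have hc : ⌈1 + k⌉₊ = ⌈k⌉₊ + 1 := by
    rw [add_comm]
    exact_mod_cast Nat.ceil_add_one hk
  simp only [expTail_eq, hc]
  exact (Real.hasDerivAt_exp t).sub (hasDerivAt_sum_pow_div_factorial _ t)

theorem expTail_nonneg {t : ℝ} (ht : 0 ≤ t) (k : ℝ) : 0 ≤ expTail t k :=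
  tsum_nonneg fun _ => by positivity

theorem expTail_le_exp {t : ℝ} (ht : 0 ≤ t) (k : ℝ) : expTail t k ≤ Real.exp t := by
  rw [expTail_eq]
  have : 0 ≤ ∑ n ∈ range ⌈k⌉₊, t ^ n / (n.factorial : ℝ) := sum_nonneg fun _ _ => by positivity
  linarith

theorem expTail_zero_add (k : ℝ) (hk : 0 ≤ k) : expTail 0 (1 + k) = 0 := by
  have hc : ⌈1 + k⌉₊ = ⌈k⌉₊ + 1 := by
    rw [add_comm]
    exact_mod_cast Nat.ceil_add_one hk
  rw [expTail_eq, hc, sum_range_succ']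
  simp

theorem expTail_one (t : ℝ) : expTail t 1 = Real.exp t - 1 := by
  simp [expTail_eq]

/-- Partial sums of the exponential series that start at `⌈k⌉` are bounded by the tail. -/
theorem sum_pow_div_factorial_le_expTail {t : ℝ} (ht : 0 ≤ t) (k : ℝ) (n : ℕ) :
    ∑ j ∈ range n, (if j < ⌈k⌉₊ then 0 else t ^ j / (j.factorial : ℝ)) ≤ expTail t k := by
  have h1 : ∑ j ∈ range n, (if j < ⌈k⌉₊ then 0 else t ^ j / (j.factorial : ℝ)) ≤
      ∑ j ∈ range (max n ⌈k⌉₊), (if j < ⌈k⌉₊ then 0 else t ^ j / (j.factorial : ℝ)) := by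
    refine sum_le_sum_of_subset_of_nonneg (range_subset_range.2 (le_max_left _ _)) ?_
    intro j _ _
    split_ifs <;> positivity
  have h2 : ∑ j ∈ range (max n ⌈k⌉₊), (if j < ⌈k⌉₊ then 0 else t ^ j / (j.factorial : ℝ)) +
      ∑ j ∈ range ⌈k⌉₊, t ^ j / (j.factorial : ℝ) =
      ∑ j ∈ range (max n ⌈k⌉₊), t ^ j / (j.factorial : ℝ) := by
    have h3 : ∑ j ∈ range ⌈k⌉₊, t ^ j / (j.factorial : ℝ) =
        ∑ j ∈ range (max n ⌈k⌉₊), (if j < ⌈k⌉₊ then t ^ j / (j.factorial : ℝ) else 0) := by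
      rw [← sum_filter]
      congr 1
      ext j
      simp only [mem_range, mem_filter]
      omega
    rw [h3, ← sum_add_distrib]
    refine sum_congr rfl fun j _ => ?_
    split_ifs <;> simp
  have h4 := Real.sum_le_exp_of_nonneg ht (max n ⌈k⌉₊)
  rw [expTail_eq]
  linarith

end ExpTail

/-! ### Decay functions, convolution constant and tails -/

section FFunctions

open Finset Filter Topology

variable {Γ : Type*} [MetricSpace Γ] {F : ℝ → ℝ}

theorem IsFFunction.apply_dist_pos (hF : IsFFunction Γ F) (x y : Γ) : 0 < F (dist x y) :=
  hF.pos _ dist_nonneg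

theorem convConst_nonneg (Γ : Type*) [MetricSpace Γ] (F : ℝ → ℝ) : 0 ≤ convConst Γ F :=
  Real.sInf_nonneg fun _ h => h.1.le

/-- The infimum defining `C_F` is itself admissible, being a limit of non-strict bounds. -/
theorem IsFFunction.tsum_le_convConst (hF : IsFFunction Γ F) (x y : Γ) :
    ∑' z : Γ, F (dist x z) * F (dist z y) ≤ convConst Γ F * F (dist x y) := by
  rw [← div_le_iff₀ (hF.apply_dist_pos x y)]
  obtain ⟨C, hC, h⟩ := hF.convolution
  refine le_csInf ⟨C, hC, fun x y => (h x y).2⟩ ?_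
  rintro D ⟨-, hD⟩
  rw [div_le_iff₀ (hF.apply_dist_pos x y)]
  exact hD x y

theorem IsFFunction.sum_mul_le (hF : IsFFunction Γ F) (s : Finset Γ) (x y : Γ) :
    ∑ z ∈ s, F (dist x z) * F (dist z y) ≤ convConst Γ F * F (dist x y) := by
  obtain ⟨C, hC, h⟩ := hF.convolution
  exact ((h x y).1.sum_le_tsum s fun z _ =>
    (mul_pos (hF.apply_dist_pos x z) (hF.apply_dist_pos z y)).le).trans (hF.tsum_le_convConst x y)

/-- The single summand `z = x = y` already gives `F 0 ≤ C_F`. For empty `Γ` the infimum is `0`. -/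
theorem IsFFunction.convConst_pos [Nonempty Γ] (hF : IsFFunction Γ F) : 0 < convConst Γ F := by
  obtain ⟨x⟩ := ‹Nonempty Γ›
  have h := hF.sum_mul_le {x} x x
  rw [sum_singleton] at h
  have h0 := hF.apply_dist_pos x x
  exact h0.trans_le (le_of_mul_le_mul_right h h0)

theorem IsFFunction.bddAbove_tail (hF : IsFFunction Γ F) (r : ℝ) :
    BddAbove (Set.range fun x : Γ => ∑' y : {y : Γ // r < dist x y}, F (dist x y)) := by
  obtain ⟨B, hB⟩ := hF.bddAbove
  refine ⟨B, ?_⟩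
  rintro _ ⟨x, rfl⟩
  exact ((hF.summable x).tsum_subtype_le (fun y => F (dist x y)) {y : Γ | r < dist x y}
    (fun y => (hF.apply_dist_pos x y).le)).trans (hB ⟨x, rfl⟩)

theorem IsFFunction.tailSup_nonneg (hF : IsFFunction Γ F) (r : ℝ) : 0 ≤ tailSup Γ F r :=
  Real.iSup_nonneg fun x => tsum_nonneg fun y => (hF.apply_dist_pos x y).le

theorem IsFFunction.sum_filter_le_tailSup (hF : IsFFunction Γ F) (s : Finset Γ) (x : Γ) (r : ℝ) :
    ∑ y ∈ s with r < dist x y, F (dist x y) ≤ tailSup Γ F r := by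
  have hs : Summable fun y : {y : Γ // r < dist x y} => F (dist x y) :=
    (hF.summable x).subtype {y : Γ | r < dist x y}
  refine le_trans ?_ (le_ciSup (hF.bddAbove_tail r) x)
  rw [← sum_subtype_eq_sum_filter (f := fun y => F (dist x y))]
  exact hs.sum_le_tsum _ fun y _ => (hF.apply_dist_pos x y).le

/-- Infinitely many summands at least `F r > 0` would contradict summability. Finiteness matters
since `ncard` assigns `0` to infinite sets, which would spoil the term `|X(r)|`. -/
theorem IsFFunction.finite_closedBall (hF : IsFFunction Γ F) (x : Γ) {r : ℝ} (hr : 0 ≤ r) :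
    {y : Γ | dist y x ≤ r}.Finite := by
  have h := (hF.summable x).tendsto_cofinite_zero.eventually_lt_const (hF.pos r hr)
  refine Set.Finite.subset h fun y hy => ?_
  change dist y x ≤ r at hy
  rw [dist_comm] at hy
  exact not_lt.2 <| hF.antitone (Set.mem_Ici.2 dist_nonneg) (Set.mem_Ici.2 hr) hy

theorem IsFFunction.finite_inflation (hF : IsFFunction Γ F) (X : Finset Γ) {r : ℝ} (hr : 0 ≤ r) :
    (inflation X r).Finite := by
  have : inflation X r = ⋃ x ∈ X, {y : Γ | dist y x ≤ r} := by
    ext y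
    simp [inflation]
  rw [this]
  exact X.finite_toSet.biUnion fun x _ => hF.finite_closedBall x hr

/-- On a `ν`-regular space, the tails of a decay function with finite `ν`-th moment are bounded,
uniformly in the centre, by the tails of the moment series. -/
theorem IsFFunction.sum_tail_le (hF : IsFFunction Γ F) {κ ν : ℝ} (hreg : IsRegularSpace Γ κ ν)
    (hsum : Summable fun n : ℕ => (1 + (n : ℝ)) ^ ν * F n) (x : Γ) (N : ℕ) (s : Finset Γ)
    (hs : ∀ y ∈ s, (N : ℝ) ≤ dist x y) :
    ∑ y ∈ s, F (dist x y) ≤ κ * ∑' n : ℕ, (1 + ((n + N : ℕ) : ℝ)) ^ ν * F ((n + N : ℕ) : ℝ) := by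
  classical
  obtain ⟨hκ, hν, hball⟩ := hreg
  have hsum' := (summable_nat_add_iff N).2 hsum
  have hnn : ∀ n : ℕ, 0 ≤ (1 + ((n + N : ℕ) : ℝ)) ^ ν * F ((n + N : ℕ) : ℝ) := fun n =>
    mul_nonneg (by positivity) (hF.pos _ (by positivity)).le
  -- Points are grouped into shells by the integer part of their distance. Subtracting `N` never
  -- truncates, and the shell with index `n` lies in the ball of radius `n + N + 1`.
  set T := s.image fun y => ⌊dist x y⌋₊ - N with hT
  have h1 : ∑ y ∈ s, F (dist x y) =
      ∑ n ∈ T, ∑ y ∈ s with ⌊dist x y⌋₊ - N = n, F (dist x y) :=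
    (sum_fiberwise_of_maps_to (fun y hy => mem_image_of_mem _ hy) _).symm
  rw [h1, ← tsum_mul_left]
  refine le_trans (sum_le_sum fun n _ => ?_)
    ((hsum'.mul_left κ).sum_le_tsum T fun n _ => mul_nonneg hκ.le (hnn n))
  have hfl : ∀ y ∈ s, ⌊dist x y⌋₊ - N = n → ⌊dist x y⌋₊ = n + N := by
    intro y hy h
    have := Nat.le_floor (hs y hy)
    omega
  have h2 : ∀ y ∈ s.filter (fun y => ⌊dist x y⌋₊ - N = n), F (dist x y) ≤ F ((n + N : ℕ) : ℝ) := by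
    intro y hy
    rw [mem_filter] at hy
    refine hF.antitone (Set.mem_Ici.2 (by positivity)) (Set.mem_Ici.2 dist_nonneg) ?_
    rw [← hfl y hy.1 hy.2]
    exact Nat.floor_le dist_nonneg
  have h3 := sum_le_card_nsmul _ _ _ h2
  refine h3.trans ?_
  have h4 : ((s.filter fun y => ⌊dist x y⌋₊ - N = n).card : ℝ) ≤
      κ * (1 + ((n + N : ℕ) : ℝ)) ^ ν := by
    obtain ⟨hfin, hcard⟩ := hball x (n + N)
    rw [add_comm (1 : ℝ)]
    refine le_trans ?_ hcard
    rw [← Set.ncard_coe_finset]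
    refine Nat.cast_le.2 (Set.ncard_le_ncard ?_ hfin)
    intro y hy
    rw [mem_coe, mem_filter] at hy
    rw [Metric.mem_closedBall, dist_comm]
    have h5 := (Nat.lt_floor_add_one (dist x y)).le
    rwa [hfl y hy.1 hy.2] at h5
  rw [nsmul_eq_mul, ← mul_assoc]
  exact mul_le_mul_of_nonneg_right h4 (hF.pos _ (by positivity)).le

theorem IsFFunction.tendsto_tailSup (hF : IsFFunction Γ F) {κ ν : ℝ}
    (hreg : IsRegularSpace Γ κ ν)
    (hsum : Summable fun n : ℕ => (1 + (n : ℝ)) ^ ν * F n) :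
    Tendsto (tailSup Γ F) atTop (𝓝 0) := by
  have h1 : Tendsto (fun N : ℕ => κ * ∑' n : ℕ,
      (1 + ((n + N : ℕ) : ℝ)) ^ ν * F ((n + N : ℕ) : ℝ)) atTop (𝓝 0) := by
    have := (tendsto_sum_nat_add fun n : ℕ => (1 + (n : ℝ)) ^ ν * F n).const_mul κ
    simpa using this
  have h2 := h1.comp (tendsto_nat_floor_atTop (α := ℝ))
  refine tendsto_of_tendsto_of_tendsto_of_le_of_le' tendsto_const_nhds h2
    (Eventually.of_forall fun r => hF.tailSup_nonneg r) ?_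
  filter_upwards [eventually_ge_atTop 0] with r hr
  have hB : 0 ≤ κ * ∑' n : ℕ, (1 + ((n + ⌊r⌋₊ : ℕ) : ℝ)) ^ ν * F ((n + ⌊r⌋₊ : ℕ) : ℝ) :=
    mul_nonneg hreg.1.le (tsum_nonneg fun n =>
      mul_nonneg (by positivity) (hF.pos _ (by positivity)).le)
  refine Real.iSup_le (fun x => ?_) hB
  refine Real.tsum_le_of_sum_le (fun y => (hF.apply_dist_pos x y).le) fun u => ?_
  have := hF.sum_tail_le hreg hsum x ⌊r⌋₊ (u.map (Function.Embedding.subtype _)) (by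
    intro y hy
    obtain ⟨z, -, rfl⟩ := mem_map.1 hy
    exact (Nat.floor_le hr).trans z.2.le)
  simpa using this

end FFunctions

/-! ### Weights of chains of interaction sets -/

section Chains

open Finset

variable {Γ : Type*} [DecidableEq Γ]

/-- The weight of all chains `Y, Z₁, …, Z_n, X` of successively intersecting sets, the `Z_i` being
taken from the family `𝒵`, each chain being weighted with `∏ w (Z_i)`. -/
noncomputable def chainWeight (w : Finset Γ → ℝ) (𝒵 : Finset (Finset Γ)) (X : Finset Γ) :
    ℕ → Finset Γ → ℝ
  | 0, Y => if Disjoint Y X then 0 else 1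
  | n + 1, Y => ∑ Z ∈ 𝒵 with ¬ Disjoint Z Y, w Z * chainWeight w 𝒵 X n Z

variable {w : Finset Γ → ℝ} {𝒵 : Finset (Finset Γ)} {X : Finset Γ}

theorem chainWeight_nonneg (hw : ∀ Z, 0 ≤ w Z) (n : ℕ) (Y : Finset Γ) :
    0 ≤ chainWeight w 𝒵 X n Y := by
  induction n generalizing Y with
  | zero => simp only [chainWeight]; split_ifs <;> norm_num
  | succ n ih => exact sum_nonneg fun Z _ => mul_nonneg (hw Z) (ih Z)

/-- Union bound: a set meeting `Y` contains some point of `Y`, and counting it once for every such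
point only enlarges the sum. -/
theorem sum_not_disjoint_le {f : Finset Γ → ℝ} (hf : ∀ Z, 0 ≤ f Z) (𝒴 : Finset (Finset Γ))
    (Y : Finset Γ) :
    ∑ Z ∈ 𝒴 with ¬ Disjoint Z Y, f Z ≤ ∑ y ∈ Y, ∑ Z ∈ 𝒴 with y ∈ Z, f Z := by
  simp only [sum_filter]
  rw [sum_comm]
  refine sum_le_sum fun Z _ => ?_
  have hnn : ∀ y ∈ Y, 0 ≤ if y ∈ Z then f Z else 0 := fun y _ => by
    split_ifs
    exacts [hf Z, le_rfl]
  split_ifs with h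
  · exact sum_nonneg hnn
  · obtain ⟨y, hyZ, hyY⟩ := not_disjoint_iff.1 h
    refine le_trans ?_ (single_le_sum hnn hyY)
    simp [hyZ]

variable [MetricSpace Γ] {F : ℝ → ℝ} {M : ℝ} {Λ : Finset Γ}

/-- Marking a point in each intersection leaves two marked points per link, so summing over the link
costs `M F`. Summing over the `n` intermediate points uses the convolution inequality `n` times,
hence one power of `C_F` fewer than of `M`. -/
theorem chainWeight_succ_le (hF : IsFFunction Γ F) (hw : ∀ Z, 0 ≤ w Z) (h𝒵 : ∀ Z ∈ 𝒵, Z ⊆ Λ)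
    (hM : 0 ≤ M)
    (h : ∀ x y : Γ, ∑ Z ∈ 𝒵 with x ∈ Z ∧ y ∈ Z, w Z ≤ M * F (dist x y)) (n : ℕ) (Y : Finset Γ) :
    chainWeight w 𝒵 X (n + 1) Y ≤
      M ^ (n + 1) * convConst Γ F ^ n * ∑ x ∈ X, ∑ y ∈ Y, F (dist x y) := by
  have hFnn : ∀ x y : Γ, 0 ≤ F (dist x y) := fun x y => (hF.apply_dist_pos x y).le
  have hC := convConst_nonneg Γ F
  induction n generalizing Y with
  | zero =>
    have h0 : ∀ Z, 0 ≤ w Z * chainWeight w 𝒵 X 0 Z := fun Z =>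
      mul_nonneg (hw Z) (chainWeight_nonneg hw 0 Z)
    calc chainWeight w 𝒵 X 1 Y
        ≤ ∑ y ∈ Y, ∑ Z ∈ 𝒵 with y ∈ Z, w Z * chainWeight w 𝒵 X 0 Z :=
          sum_not_disjoint_le h0 𝒵 Y
      _ = ∑ y ∈ Y, ∑ Z ∈ (𝒵.filter (y ∈ ·)) with ¬ Disjoint Z X, w Z := by
          refine sum_congr rfl fun y _ => ?_
          rw [sum_filter (s := 𝒵.filter _)]
          refine sum_congr rfl fun Z _ => ?_
          simp only [chainWeight]
          split_ifs <;> simp_all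
      _ ≤ ∑ y ∈ Y, ∑ x ∈ X, ∑ Z ∈ (𝒵.filter (y ∈ ·)) with x ∈ Z, w Z :=
          sum_le_sum fun y _ => sum_not_disjoint_le hw _ X
      _ ≤ ∑ y ∈ Y, ∑ x ∈ X, M * F (dist x y) := by
          refine sum_le_sum fun y _ => sum_le_sum fun x _ => ?_
          rw [filter_filter, dist_comm]
          exact h y x
      _ = _ := by
          rw [sum_comm]
          simp [mul_sum]
  | succ n ih =>
    set P := M ^ (n + 1) * convConst Γ F ^ n with hP
    have hPnn : 0 ≤ P := by positivity
    have hg : ∀ z, 0 ≤ ∑ x ∈ X, F (dist x z) := fun z => sum_nonneg fun x _ => hFnn x z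
    calc chainWeight w 𝒵 X (n + 1 + 1) Y
        ≤ ∑ Z ∈ 𝒵 with ¬ Disjoint Z Y, w Z * (P * ∑ z ∈ Z, ∑ x ∈ X, F (dist x z)) := by
          refine sum_le_sum fun Z _ => mul_le_mul_of_nonneg_left ?_ (hw Z)
          rw [sum_comm]
          exact ih Z
      _ ≤ ∑ y ∈ Y, ∑ Z ∈ 𝒵 with y ∈ Z, w Z * (P * ∑ z ∈ Z, ∑ x ∈ X, F (dist x z)) :=
          sum_not_disjoint_le (fun Z => mul_nonneg (hw Z)
            (mul_nonneg hPnn (sum_nonneg fun z _ => hg z))) 𝒵 Y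
      _ = ∑ y ∈ Y, ∑ z ∈ Λ, (∑ Z ∈ 𝒵 with y ∈ Z ∧ z ∈ Z, w Z) *
            (P * ∑ x ∈ X, F (dist x z)) := by
          refine sum_congr rfl fun y _ => ?_
          simp only [sum_mul, ← filter_filter]
          simp only [sum_filter (s := 𝒵.filter _)]
          rw [sum_comm]
          refine sum_congr rfl fun Z hZ => ?_
          rw [← sum_filter, filter_mem_eq_inter,
            inter_eq_right.2 (h𝒵 Z (mem_filter.1 hZ).1), mul_sum, mul_sum]
      _ ≤ ∑ y ∈ Y, ∑ z ∈ Λ, M * F (dist y z) * (P * ∑ x ∈ X, F (dist x z)) :=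
          sum_le_sum fun y _ => sum_le_sum fun z _ =>
            mul_le_mul_of_nonneg_right (h y z) (mul_nonneg hPnn (hg z))
      _ = M * P * ∑ x ∈ X, ∑ y ∈ Y, ∑ z ∈ Λ, F (dist x z) * F (dist z y) := by
          rw [sum_comm (s := X)]
          simp only [mul_sum]
          refine sum_congr rfl fun y _ => ?_
          rw [sum_comm]
          refine sum_congr rfl fun x _ => sum_congr rfl fun z _ => ?_
          rw [dist_comm y z]
          ring
      _ ≤ M * P * ∑ x ∈ X, ∑ y ∈ Y, convConst Γ F * F (dist x y) :=
          mul_le_mul_of_nonneg_left (sum_le_sum fun x _ => sum_le_sum fun y _ =>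
            hF.sum_mul_le Λ x y) (mul_nonneg hM hPnn)
      _ = _ := by
          simp only [← mul_sum]
          rw [hP]
          ring

/-- By the triangle inequality, `n` links of diameter at most `R` span a distance of at most `n *
R`. -/
theorem chainWeight_eq_zero {R : ℝ} (h𝒵 : ∀ Z ∈ 𝒵, Metric.diam (Z : Set Γ) ≤ R) (n : ℕ)
    (Y : Finset Γ) (hY : ∀ x ∈ X, ∀ y ∈ Y, n * R < dist x y) :
    chainWeight w 𝒵 X n Y = 0 := by
  induction n generalizing Y with
  | zero =>
    have : Disjoint Y X := disjoint_left.2 fun y hyY hyX => by simpa using hY y hyX y hyY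
    simp [chainWeight, this]
  | succ n ih =>
    refine sum_eq_zero fun Z hZ => ?_
    rw [mem_filter, not_disjoint_iff] at hZ
    obtain ⟨hZ, y, hyZ, hyY⟩ := hZ
    rw [ih Z, mul_zero]
    intro x hx z hz
    have h1 := hY x hx y hyY
    have h2 : dist z y ≤ R :=
      (Metric.dist_le_diam_of_mem Z.finite_toSet.isBounded hz hyZ).trans (h𝒵 Z hZ)
    have h3 := dist_triangle x z y
    push_cast at h1
    linarith

/-- The interaction terms of diameter larger than `R` at a given site. -/
theorem sum_diam_gt_le (hF : IsFFunction Γ F) (hw : ∀ Z, 0 ≤ w Z) (h𝒵 : ∀ Z ∈ 𝒵, Z ⊆ Λ)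
    (hM : 0 ≤ M)
    (h : ∀ x y : Γ, ∑ Z ∈ 𝒵 with x ∈ Z ∧ y ∈ Z, w Z ≤ M * F (dist x y)) {R : ℝ} (hR : 0 < R)
    (x : Γ) :
    ∑ Z ∈ (𝒵.filter fun Z : Finset Γ => R < Metric.diam (Z : Set Γ)) with x ∈ Z, w Z ≤
      M * tailSup Γ F (R / 2) := by
  calc ∑ Z ∈ (𝒵.filter fun Z : Finset Γ => R < Metric.diam (Z : Set Γ)) with x ∈ Z, w Z
      -- Origin of `R / 2`: if every point of `Z` were within `R / 2` of `x`, the diameter would be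
      -- at most `R`.
      ≤ ∑ Z ∈ (𝒵.filter (x ∈ ·)) with ¬ Disjoint Z (Λ.filter fun y => R / 2 < dist x y), w Z := by
        refine sum_le_sum_of_subset_of_nonneg ?_ fun Z _ _ => hw Z
        intro Z hZ
        simp only [mem_filter] at hZ ⊢
        refine ⟨⟨hZ.1.1, hZ.2⟩, fun hd => not_le.2 hZ.1.2 ?_⟩
        have hle : ∀ y ∈ Z, dist x y ≤ R / 2 := fun y hy => by
          by_contra hlt
          exact disjoint_left.1 hd hy (mem_filter.2 ⟨h𝒵 Z hZ.1.1 hy, not_le.1 hlt⟩)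
        refine Metric.diam_le_of_forall_dist_le hR.le fun y hy z hz => ?_
        have h1 := dist_triangle_left y z x
        have h2 := hle y hy
        have h3 := hle z hz
        linarith
    _ ≤ ∑ y ∈ Λ with R / 2 < dist x y, ∑ Z ∈ (𝒵.filter (x ∈ ·)) with y ∈ Z, w Z :=
        sum_not_disjoint_le hw _ _
    _ ≤ ∑ y ∈ Λ with R / 2 < dist x y, M * F (dist x y) := by
        refine sum_le_sum fun y _ => ?_
        rw [filter_filter]
        exact h x y
    _ ≤ M * tailSup Γ F (R / 2) := by
        rw [← mul_sum]
        exact mul_le_mul_of_nonneg_left (hF.sum_filter_le_tailSup Λ x _) hM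

end Chains

/-! ### Lindblad generators and completely bounded maps on matrix algebras -/

section MatrixAlgebras

open Matrix

variable {I J m : Type*} [Fintype I] [DecidableEq I] [Fintype J] [DecidableEq J]
  [Fintype m] [DecidableEq m]

/-- `A ↦ A ⊗ 𝟙` as a star algebra homomorphism. -/
noncomputable def tensorOne (I m : Type*) [Fintype I] [DecidableEq I] [Fintype m]
    [DecidableEq m] : Matrix I I ℂ →⋆ₐ[ℂ] Matrix (I × m) (I × m) ℂ where
  toFun A := kroneckerMap (· * ·) A 1
  map_one' := one_kronecker_one
  map_mul' A B := by
    have h := mul_kronecker_mul A B (1 : Matrix m m ℂ) (1 : Matrix m m ℂ)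
    rw [Matrix.one_mul] at h
    exact h
  map_zero' := zero_kronecker _
  map_add' A B := add_kronecker A B _
  commutes' c := by
    rw [Algebra.algebraMap_eq_smul_one, Algebra.algebraMap_eq_smul_one]
    exact (smul_kronecker c _ _).trans (congrArg _ one_kronecker_one)
  map_star' A := by
    have h := conjTranspose_kronecker A (1 : Matrix m m ℂ)
    rw [conjTranspose_one] at h
    exact h.symm

/-- Relabelling of the basis as a star algebra homomorphism. -/
def relabel (e : J ≃ I) : Matrix I I ℂ →⋆ₐ[ℂ] Matrix J J ℂ where
  toFun A := A.submatrix e e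
  map_one' := submatrix_one_equiv e
  map_mul' A B := (submatrix_mul_equiv A B e e e).symm
  map_zero' := rfl
  map_add' _ _ := rfl
  commutes' c := by
    rw [Algebra.algebraMap_eq_smul_one, Algebra.algebraMap_eq_smul_one]
    ext i j
    simp [Matrix.one_apply]
  map_star' _ := rfl

theorem tensorOne_apply (A : Matrix I I ℂ) (p q : I × m) :
    tensorOne I m A p q = A p.1 q.1 * (1 : Matrix m m ℂ) p.2 q.2 := rfl

theorem relabel_apply (e : J ≃ I) (A : Matrix I I ℂ) (i j : J) :
    relabel e A i j = A (e i) (e j) := rfl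

theorem relabel_symm_relabel (e : J ≃ I) (A : Matrix I I ℂ) :
    relabel e.symm (relabel e A) = A := by
  ext i j
  simp [relabel_apply]

theorem norm_relabel (e : J ≃ I) (A : Matrix I I ℂ) : ‖relabel e A‖ = ‖A‖ := by
  refine le_antisymm (NonUnitalStarAlgHom.norm_apply_le _ A) ?_
  conv_lhs => rw [← relabel_symm_relabel e A]
  exact NonUnitalStarAlgHom.norm_apply_le _ _

theorem norm_tensorOne_le (A : Matrix I I ℂ) : ‖tensorOne I m A‖ ≤ ‖A‖ :=
  NonUnitalStarAlgHom.norm_apply_le _ A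

/-- Only an inequality, since `I` may be empty and then `1 = 0`. -/
theorem norm_one_matrix_le : ‖(1 : Matrix I I ℂ)‖ ≤ 1 := by
  have h : ‖(1 : Matrix I I ℂ)‖ = ‖(1 : Matrix I I ℂ)‖ * ‖(1 : Matrix I I ℂ)‖ := by
    simpa using CStarRing.norm_star_mul_self (x := (1 : Matrix I I ℂ))
  nlinarith [norm_nonneg (1 : Matrix I I ℂ), sq_nonneg (‖(1 : Matrix I I ℂ)‖ - 1)]

/-- A completely positive map in Kraus form attains its norm at the identity. -/
theorem norm_sum_star_mul_mul_le (V : m → Matrix I I ℂ) (A : Matrix I I ℂ) :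
    ‖∑ j, star (V j) * A * V j‖ ≤ ‖∑ j, star (V j) * V j‖ * ‖A‖ := by
  -- Stacking the Kraus operators into a column `W` turns the map into `Wᴴ (A ⊗ 1) W`, and the
  -- C*-identity gives `‖W‖²` as the norm of its value at `1`.
  set W : Matrix (I × m) I ℂ := Matrix.of fun p k => V p.2 p.1 k with hW
  have h : ∀ B : Matrix I I ℂ, ∑ j, star (V j) * B * V j = Wᴴ * (tensorOne I m B * W) := by
    intro B
    ext i k
    simp only [Matrix.sum_apply, Matrix.mul_assoc]
    simp only [Matrix.mul_apply, Fintype.sum_prod_type, tensorOne_apply, hW,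
      conjTranspose_apply, Matrix.of_apply, Matrix.star_apply, one_apply]
    rw [Finset.sum_comm]
    simp
  have h1 := h 1
  simp only [Matrix.mul_one, map_one, Matrix.one_mul] at h1
  rw [h A, h1, l2_opNorm_conjTranspose_mul_self]
  have h2 := l2_opNorm_mul Wᴴ (tensorOne I m A * W)
  have h3 := l2_opNorm_mul (tensorOne I m A) W
  rw [l2_opNorm_conjTranspose] at h2
  have h4 := norm_tensorOne_le (m := m) A
  calc _ ≤ ‖W‖ * (‖A‖ * ‖W‖) := h2.trans (by gcongr; exact h3.trans (by gcongr))
    _ = _ := by ring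

/-- The form `A ↦ G* A + A G + ∑ⱼ Kⱼ* A Kⱼ`, with the value at `𝟙` equal to zero, of a
Lindblad generator. -/
def IsGKSL (Φ : Matrix I I ℂ →ₗ[ℂ] Matrix I I ℂ) : Prop :=
  ∃ (G : Matrix I I ℂ) (l : ℕ) (K : Fin l → Matrix I I ℂ),
    star G + G + ∑ j, star (K j) * K j = 0 ∧
    Φ = LinearMap.mulLeftRight ℂ (star G, 1) + LinearMap.mulLeftRight ℂ (1, G) +
      ∑ j, LinearMap.mulLeftRight ℂ (star (K j), K j)

/-- The Hamiltonian and the anticommutator are absorbed into `G = -iH - ½ ∑ Kⱼ* Kⱼ`. Only two-sided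
multiplications remain, so the form survives ampliation. -/
theorem IsLindblad.isGKSL {Φ : Matrix I I ℂ →ₗ[ℂ] Matrix I I ℂ} (h : IsLindblad Φ) :
    IsGKSL Φ := by
  obtain ⟨H, l, K, hH, hΦ⟩ := h
  set P := ∑ j, star (K j) * K j with hP
  have hPs : star P = P := by simp [hP, star_sum]
  set G := -(Complex.I • H) - (1 / 2 : ℂ) • P with hG
  have hGs : star G = Complex.I • H - (1 / 2 : ℂ) • P := by
    rw [hG, star_sub, star_neg, star_smul, star_smul, hH.star_eq, hPs]
    simp
  refine ⟨G, l, K, ?_, ?_⟩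
  · rw [hGs, hG, ← hP]
    module
  · refine LinearMap.ext fun A => ?_
    have h1 : ∑ j, (star (K j) * A * K j -
        (1 / 2 : ℂ) • (star (K j) * K j * A + A * (star (K j) * K j))) =
        ∑ j, star (K j) * A * K j - (1 / 2 : ℂ) • (P * A + A * P) := by
      rw [Finset.sum_sub_distrib, ← Finset.smul_sum, Finset.sum_add_distrib, hP,
        Finset.sum_mul, Finset.mul_sum]
    rw [hΦ, h1]
    simp only [LinearMap.add_apply, LinearMap.sum_apply, LinearMap.mulLeftRight_apply, mul_one,
      one_mul, hGs]
    rw [hG]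
    simp only [sub_mul, mul_sub, mul_neg, smul_mul_assoc, mul_smul_comm, smul_add, smul_sub]
    abel

theorem IsLindblad.map_one {Φ : Matrix I I ℂ →ₗ[ℂ] Matrix I I ℂ} (h : IsLindblad Φ) :
    Φ 1 = 0 := by
  obtain ⟨G, l, K, hG, rfl⟩ := h.isGKSL
  simpa using hG

theorem ampliation_mulLeftRight (a b : Matrix I I ℂ) :
    ampliation m (LinearMap.mulLeftRight ℂ (a, b)) =
      LinearMap.mulLeftRight ℂ (tensorOne I m a, tensorOne I m b) := by
  refine LinearMap.ext fun B => ?_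
  ext ⟨i, p⟩ ⟨j, q⟩
  simp only [ampliation, LinearMap.coe_mk, AddHom.coe_mk, LinearMap.mulLeftRight_apply,
    Matrix.of_apply, Matrix.mul_apply, Fintype.sum_prod_type, tensorOne_apply, one_apply]
  simp

theorem IsGKSL.ampliation {Φ : Matrix I I ℂ →ₗ[ℂ] Matrix I I ℂ} (h : IsGKSL Φ) :
    IsGKSL (ampliation m Φ) := by
  obtain ⟨G, l, K, hG, rfl⟩ := h
  refine ⟨tensorOne I m G, l, fun j => tensorOne I m (K j), ?_, ?_⟩
  · have := congrArg (tensorOne I m) hG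
    simpa only [map_add, map_sum, map_mul, map_star, map_zero] using this
  · have hadd : ∀ Φ Ψ : Matrix I I ℂ →ₗ[ℂ] Matrix I I ℂ,
        _root_.ampliation m (Φ + Ψ) = _root_.ampliation m Φ + _root_.ampliation m Ψ :=
      fun _ _ => rfl
    have hsum : _root_.ampliation m (∑ j, LinearMap.mulLeftRight ℂ (star (K j), K j)) =
        ∑ j, _root_.ampliation m (LinearMap.mulLeftRight ℂ (star (K j), K j)) :=
      map_sum (AddMonoidHom.mk' (_root_.ampliation m) hadd) _ _
    rw [hadd, hadd, hsum]
    simp only [ampliation_mulLeftRight, map_star, _root_.map_one]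

/-- `A + εΦ(A) + ε² G* A G` is completely positive with Kraus operators `1 + εG` and `√ε Kⱼ`. Its
value at `1` is `1 + ε² G* G`. Removing the quadratic term costs another `ε² ‖G‖²`, whence the
constant `2 ‖G‖²`. -/
theorem IsGKSL.exists_norm_le {Φ : Matrix I I ℂ →ₗ[ℂ] Matrix I I ℂ} (h : IsGKSL Φ) :
    ∃ c : ℝ, ∀ ε : ℝ, 0 < ε → ∀ A, ‖A + (ε : ℂ) • Φ A‖ ≤ (1 + c * ε ^ 2) * ‖A‖ := by
  obtain ⟨G, l, K, hG, rfl⟩ := h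
  refine ⟨2 * ‖G‖ ^ 2, fun ε hε A => ?_⟩
  set V : Option (Fin l) → Matrix I I ℂ := fun o =>
    o.elim (1 + (ε : ℂ) • G) fun j => ((Real.sqrt ε : ℝ) : ℂ) • K j with hV
  have hexp : ∀ B, ∑ o, star (V o) * B * V o =
      B + (ε : ℂ) • (LinearMap.mulLeftRight ℂ (star G, 1) + LinearMap.mulLeftRight ℂ (1, G) +
      ∑ j, LinearMap.mulLeftRight ℂ (star (K j), K j)) B +
        ((ε ^ 2 : ℝ) : ℂ) • (star G * B * G) := by
    intro B
    have hs : ((Real.sqrt ε : ℝ) : ℂ) * ((Real.sqrt ε : ℝ) : ℂ) = (ε : ℂ) := by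
      rw [← Complex.ofReal_mul, Real.mul_self_sqrt hε.le]
    rw [Fintype.sum_option]
    simp only [hV, Option.elim, star_add, star_one, star_smul, RCLike.star_def, Complex.conj_ofReal,
      LinearMap.add_apply, LinearMap.sum_apply, LinearMap.mulLeftRight_apply, mul_one, one_mul,
      smul_mul_assoc, mul_smul_comm, smul_smul, hs, ← Finset.smul_sum, add_mul, mul_add, smul_add]
    rw [Complex.ofReal_pow, sq]
    abel
  have h1 := norm_sum_star_mul_mul_le V A
  have h2 := hexp A
  have h3 := hexp 1
  have h0 : (LinearMap.mulLeftRight ℂ (star G, 1) + LinearMap.mulLeftRight ℂ (1, G) +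
      ∑ j, LinearMap.mulLeftRight ℂ (star (K j), K j)) (1 : Matrix I I ℂ) = 0 := by
    simpa using hG
  rw [h0, smul_zero, add_zero] at h3
  simp only [mul_one] at h3
  have h4 : ‖((ε ^ 2 : ℝ) : ℂ)‖ = ε ^ 2 := by
    rw [Complex.norm_real, Real.norm_of_nonneg (by positivity)]
  have h5 : ‖∑ o, star (V o) * V o‖ ≤ 1 + ε ^ 2 * ‖G‖ ^ 2 := by
    rw [h3]
    refine (norm_add_le _ _).trans (add_le_add norm_one_matrix_le ?_)
    rw [norm_smul, h4, CStarRing.norm_star_mul_self, sq ‖G‖]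
  have h6 : ‖((ε ^ 2 : ℝ) : ℂ) • (star G * A * G)‖ ≤ ε ^ 2 * (‖G‖ ^ 2 * ‖A‖) := by
    rw [norm_smul, h4]
    gcongr
    refine (norm_mul_le _ _).trans ?_
    have := norm_mul_le (star G) A
    rw [norm_star] at this
    nlinarith [norm_nonneg G, mul_le_mul_of_nonneg_right this (norm_nonneg G)]
  rw [← sub_eq_iff_eq_add] at h2
  rw [← h2]
  refine (norm_sub_le _ _).trans ?_
  have h7 := mul_le_mul_of_nonneg_right h5 (norm_nonneg A)
  linarith

theorem norm_ampliation_le {Φ : Matrix I I ℂ →ₗ[ℂ] Matrix I I ℂ} (hΦ : cbNorm Φ < ∞)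
    (B : Matrix (I × m) (I × m) ℂ) : ‖ampliation m Φ B‖ ≤ (cbNorm Φ).toReal * ‖B‖ := by
  set n := Fintype.card m
  let e : I × Fin n ≃ I × m := Equiv.prodCongr (Equiv.refl I) (Fintype.equivFin m).symm
  have h : relabel e (ampliation m Φ B) = ampliation (Fin n) Φ (relabel e B) := rfl
  rw [← norm_relabel e, h, ← norm_relabel e B]
  have h1 := (LinearMap.toContinuousLinearMap (ampliation (Fin n) Φ)).le_opNorm (relabel e B)
  refine h1.trans (mul_le_mul_of_nonneg_right ?_ (norm_nonneg _))
  have h2 : ‖LinearMap.toContinuousLinearMap (ampliation (Fin n) Φ)‖ₑ ≤ cbNorm Φ :=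
    le_iSup (fun n : ℕ => ‖LinearMap.toContinuousLinearMap (ampliation (Fin n) Φ)‖ₑ) n
  have h3 := ENNReal.toReal_mono hΦ.ne h2
  rwa [toReal_enorm] at h3

/-- Settles the degenerate case of an empty `Γ`, where observables are scalars. -/
theorem eq_zero_of_subsingleton [Subsingleton I] {Φ : Matrix I I ℂ →ₗ[ℂ] Matrix I I ℂ}
    (h : Φ 1 = 0) : Φ = 0 := by
  refine LinearMap.ext fun A => ?_
  rcases isEmpty_or_nonempty I with hI | ⟨⟨i⟩⟩
  · exact Subsingleton.elim _ _
  · have hA : A = A i i • (1 : Matrix I I ℂ) := by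
      ext j k
      rw [Subsingleton.elim j i, Subsingleton.elim k i]
      simp
    rw [hA, map_smul, h, smul_zero, LinearMap.zero_apply]

end MatrixAlgebras

/-! ### Gluing of configurations -/

section Gluing

variable {Γ : Type*} [DecidableEq Γ] {ι : Γ → Type*} {X Y Z Λ : Finset Γ}

/-- The configuration that agrees with `i` on `X` and with `σ` off `X`. -/
def glue (h : X ⊆ Λ) (i : Config ι X) (σ : Config ι Λ) : Config ι Λ :=
  (splitConfig ι h).symm (i, (splitConfig ι h σ).2)

theorem glue_apply (h : X ⊆ Λ) (i : Config ι X) (σ : Config ι Λ) (x : {x // x ∈ Λ}) :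
    glue h i σ x = if hx : (x : Γ) ∈ X then i ⟨x, hx⟩ else σ x := rfl

theorem glue_comm (hY : Y ⊆ Λ) (hZ : Z ⊆ Λ) (hd : Disjoint Y Z) (i : Config ι Y)
    (k : Config ι Z) (σ : Config ι Λ) : glue hY i (glue hZ k σ) = glue hZ k (glue hY i σ) := by
  funext x
  simp only [glue_apply]
  by_cases h1 : (x : Γ) ∈ Y
  · simp [h1, Finset.disjoint_left.1 hd h1]
  · simp [h1]

theorem splitConfig_glue_fst (hY : Y ⊆ Λ) (hZ : Z ⊆ Λ) (hd : Disjoint Y Z) (i : Config ι Y)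
    (σ : Config ι Λ) : (splitConfig ι hZ (glue hY i σ)).1 = (splitConfig ι hZ σ).1 := by
  funext x
  have h1 : (x : Γ) ∉ Y := Finset.disjoint_right.1 hd x.2
  simp [splitConfig, glue_apply, h1]

end Gluing

/-! ### Extensions of local maps: norms, commutation, locality -/

section LocalAlgebras

open Matrix

variable {Γ : Type*} [DecidableEq Γ] {ι : Γ → Type*} [∀ x, Fintype (ι x)]
  [∀ x, DecidableEq (ι x)] {X Y Z Λ : Finset Γ}

theorem norm_embed_le (h : X ⊆ Λ) (A : LocalAlg ι X) : ‖embed h A‖ ≤ ‖A‖ := by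
  have h1 : embed h A = relabel (splitConfig ι h) (tensorOne _ (Config ι (Λ \ X)) A) := rfl
  rw [h1, norm_relabel]
  exact norm_tensorOne_le A

theorem extend_eq_relabel (h : X ⊆ Λ) (Φ : LocalAlg ι X →ₗ[ℂ] LocalAlg ι X) (B : LocalAlg ι Λ) :
    extend h Φ B = relabel (splitConfig ι h)
      (ampliation (Config ι (Λ \ X)) Φ (relabel (splitConfig ι h).symm B)) := rfl

theorem norm_extend_le (h : X ⊆ Λ) {Φ : LocalAlg ι X →ₗ[ℂ] LocalAlg ι X} (hΦ : cbNorm Φ < ∞)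
    (B : LocalAlg ι Λ) : ‖extend h Φ B‖ ≤ (cbNorm Φ).toReal * ‖B‖ := by
  rw [extend_eq_relabel, norm_relabel]
  refine (norm_ampliation_le hΦ _).trans_eq ?_
  rw [norm_relabel]

theorem IsLindblad.isDissipative_extend (h : X ⊆ Λ) {Φ : LocalAlg ι X →ₗ[ℂ] LocalAlg ι X}
    (hΦ : IsLindblad Φ) : IsDissipative (LinearMap.toContinuousLinearMap (extend h Φ)) := by
  obtain ⟨c, hc⟩ := (hΦ.isGKSL.ampliation (m := Config ι (Λ \ X))).exists_norm_le
  refine ⟨c, fun ε hε B => ?_⟩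
  rw [LinearMap.coe_toContinuousLinearMap']
  have h1 := hc ε hε (relabel (splitConfig ι h).symm B)
  rw [norm_relabel, ← norm_relabel (splitConfig ι h), map_add, map_smul] at h1
  rw [extend_eq_relabel]
  refine le_trans (le_of_eq ?_) h1
  congr 2
  exact (relabel_symm_relabel (splitConfig ι h).symm B).symm

theorem extend_apply (h : X ⊆ Λ) (Φ : LocalAlg ι X →ₗ[ℂ] LocalAlg ι X) (B : LocalAlg ι Λ)
    (σ τ : Config ι Λ) :
    extend h Φ B σ τ = Φ (Matrix.of fun i j => B (glue h i σ) (glue h j τ))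
      (splitConfig ι h σ).1 (splitConfig ι h τ).1 := rfl

/-- Expansion in matrix units writes the extension as a finite kernel, so that commutation of two
extensions becomes an exchange of sums. -/
theorem extend_apply_eq_sum (h : X ⊆ Λ) (Φ : LocalAlg ι X →ₗ[ℂ] LocalAlg ι X)
    (B : LocalAlg ι Λ) (σ τ : Config ι Λ) :
    extend h Φ B σ τ = ∑ p : Config ι X × Config ι X, B (glue h p.1 σ) (glue h p.2 τ) *
      Φ (Matrix.single p.1 p.2 1) (splitConfig ι h σ).1 (splitConfig ι h τ).1 := by
  rw [extend_apply, Fintype.sum_prod_type]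
  conv_lhs => rw [Matrix.matrix_eq_sum_single (Matrix.of fun i j => B (glue h i σ) (glue h j τ))]
  simp only [map_sum, Matrix.sum_apply]
  refine Finset.sum_congr rfl fun i _ => Finset.sum_congr rfl fun j _ => ?_
  have h1 : Matrix.single i j ((Matrix.of fun i j => B (glue h i σ) (glue h j τ)) i j) =
      (B (glue h i σ) (glue h j τ)) • Matrix.single i j (1 : ℂ) := by
    rw [Matrix.smul_single, smul_eq_mul, mul_one, Matrix.of_apply]
  rw [h1, map_smul, Matrix.smul_apply, smul_eq_mul]

/-- Maps with disjoint supports commute. -/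
theorem extend_comm (hY : Y ⊆ Λ) (hZ : Z ⊆ Λ) (hd : Disjoint Y Z)
    (Φ : LocalAlg ι Y →ₗ[ℂ] LocalAlg ι Y) (Ψ : LocalAlg ι Z →ₗ[ℂ] LocalAlg ι Z)
    (B : LocalAlg ι Λ) : extend hY Φ (extend hZ Ψ B) = extend hZ Ψ (extend hY Φ B) := by
  ext σ τ
  simp only [extend_apply_eq_sum, splitConfig_glue_fst hY hZ hd,
    splitConfig_glue_fst hZ hY hd.symm, Finset.sum_mul, glue_comm hY hZ hd]
  rw [Finset.sum_comm]
  refine Finset.sum_congr rfl fun p _ => Finset.sum_congr rfl fun q _ => ?_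
  ring

/-- A map that annihilates the identity annihilates all observables supported elsewhere. -/
theorem extend_embed_eq_zero (hX : X ⊆ Λ) (hY : Y ⊆ Λ) (hd : Disjoint Y X)
    {Φ : LocalAlg ι Y →ₗ[ℂ] LocalAlg ι Y} (hΦ : Φ 1 = 0) (A : LocalAlg ι X) :
    extend hY Φ (embed hX A) = 0 := by
  ext σ τ
  rw [extend_apply]
  -- With the configurations off `Y` frozen, the `Y`-block of `A ⊗ 1` is a multiple of `1`: the
  -- entry of `A` does not see `Y`, and the identity factor forces agreement off `X ∪ Y` and on `Y`.
  have key : ∃ c : ℂ, (Matrix.of fun i j => embed hX A (glue hY i σ) (glue hY j τ)) =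
      c • (1 : LocalAlg ι Y) := by
    classical
    refine ⟨A (splitConfig ι hX σ).1 (splitConfig ι hX τ).1 *
      if ∀ x : {x // x ∈ Λ}, (x : Γ) ∉ X → (x : Γ) ∉ Y → σ x = τ x then 1 else 0, ?_⟩
    ext i j
    simp only [Matrix.of_apply, embed, Matrix.submatrix_apply, Matrix.kroneckerMap_apply,
      splitConfig_glue_fst hY hX hd, Matrix.smul_apply, smul_eq_mul, Matrix.one_apply, mul_assoc]
    congr 1
    have hiff : (splitConfig ι hX (glue hY i σ)).2 = (splitConfig ι hX (glue hY j τ)).2 ↔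
        (∀ x : {x // x ∈ Λ}, (x : Γ) ∉ X → (x : Γ) ∉ Y → σ x = τ x) ∧ i = j := by
      constructor
      · intro h
        refine ⟨fun x hxX hxY => ?_, funext fun x => ?_⟩
        · have := congrFun h ⟨x, Finset.mem_sdiff.2 ⟨x.2, hxX⟩⟩
          simpa [splitConfig, glue_apply, hxY] using this
        · have := congrFun h ⟨x, Finset.mem_sdiff.2 ⟨hY x.2, Finset.disjoint_left.1 hd x.2⟩⟩
          simpa [splitConfig, glue_apply] using this
      · rintro ⟨h, rfl⟩
        funext x
        obtain ⟨hxΛ, hxX⟩ := Finset.mem_sdiff.1 x.2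
        by_cases hxY : (x : Γ) ∈ Y
        · simp [splitConfig, glue_apply, hxY]
        · simpa [splitConfig, glue_apply, hxY] using h ⟨x, hxΛ⟩ hxX hxY
    simp only [hiff]
    split_ifs <;> simp_all
  obtain ⟨c, hc⟩ := key
  rw [hc, map_smul, hΦ, smul_zero]
  rfl

end LocalAlgebras

/-! ### Chain expansion and Lieb-Robinson bound -/

section LiebRobinson

open Finset

variable {Γ : Type*} [DecidableEq Γ] {ι : Γ → Type*} [∀ x, Fintype (ι x)]
  [∀ x, DecidableEq (ι x)]

/-- The interaction term `L_Z`, acting on the volume `Λ`. -/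
noncomputable def localTerm (L : ∀ Z : Finset Γ, LocalAlg ι Z →ₗ[ℂ] LocalAlg ι Z) (Λ Z : Finset Γ) :
    LocalAlg ι Λ →L[ℂ] LocalAlg ι Λ :=
  if h : Z ⊆ Λ then LinearMap.toContinuousLinearMap (extend h (L Z)) else 0

/-- The sum of the interaction terms over a family of sets. -/
noncomputable def partialGenerator (L : ∀ Z : Finset Γ, LocalAlg ι Z →ₗ[ℂ] LocalAlg ι Z)
    (Λ : Finset Γ) (𝒵 : Finset (Finset Γ)) : LocalAlg ι Λ →L[ℂ] LocalAlg ι Λ :=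
  ∑ Z ∈ 𝒵, localTerm L Λ Z

variable {L : ∀ Z : Finset Γ, LocalAlg ι Z →ₗ[ℂ] LocalAlg ι Z} {Λ X : Finset Γ}
  {𝒵 : Finset (Finset Γ)}

theorem localTerm_apply {Z : Finset Γ} (h : Z ⊆ Λ) (B : LocalAlg ι Λ) :
    localTerm L Λ Z B = extend h (L Z) B := by
  rw [localTerm, dif_pos h]
  rfl

theorem toContinuousLinearMap_generator :
    LinearMap.toContinuousLinearMap (generator L Λ) = partialGenerator L Λ Λ.powerset := by
  rw [generator, map_sum, partialGenerator, ← sum_attach Λ.powerset]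
  refine sum_congr rfl fun Z _ => ?_
  rw [localTerm, dif_pos (mem_powerset.1 Z.2)]

theorem toContinuousLinearMap_generatorRange [MetricSpace Γ] (R : ℝ) :
    LinearMap.toContinuousLinearMap (generatorRange L Λ R) = partialGenerator L Λ
      (Λ.powerset.filter fun Z : Finset Γ => Metric.diam (Z : Set Γ) ≤ R) := by
  rw [generatorRange, map_sum, partialGenerator, sum_filter, sum_filter, ← sum_attach Λ.powerset]
  refine sum_congr rfl fun Z _ => ?_
  rw [localTerm, dif_pos (mem_powerset.1 Z.2)]

theorem isDissipative_partialGenerator (hL : ∀ Z, IsLindblad (L Z)) :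
    IsDissipative (partialGenerator L Λ 𝒵) := by
  refine IsDissipative.sum _ fun Z _ => ?_
  rw [localTerm]
  split_ifs with h
  exacts [(hL Z).isDissipative_extend h, IsDissipative.zero]

/-- The iterated Duhamel expansion behind the Lieb-Robinson bound, with remainder. -/
theorem norm_extend_exp_embed_le (hLindblad : ∀ Z, IsLindblad (L Z))
    (hcb : ∀ Z : Finset Γ, Z.Nonempty → cbNorm (L Z) < ∞) (h𝒵 : ∀ Z ∈ 𝒵, Z ⊆ Λ) (hX : X ⊆ Λ)
    (A : LocalAlg ι X) (n : ℕ) {Y : Finset Γ} (hY : Y ⊆ Λ)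
    {K : LocalAlg ι Y →ₗ[ℂ] LocalAlg ι Y} (hK : IsCB0 K) {t : ℝ} (ht : 0 ≤ t) :
    ‖extend hY K (NormedSpace.exp ((t : ℂ) • partialGenerator L Λ 𝒵) (embed hX A))‖ ≤
      (cbNorm K).toReal * ‖A‖ *
        (∑ j ∈ range n, t ^ j / (j.factorial : ℝ) *
            chainWeight (fun Z => (cbNorm (L Z)).toReal) 𝒵 X j Y +
          t ^ n / (n.factorial : ℝ) * (∑ Z ∈ 𝒵, (cbNorm (L Z)).toReal) ^ n) := by
  set w : Finset Γ → ℝ := fun Z => (cbNorm (L Z)).toReal with hw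
  have hwnn : ∀ Z, 0 ≤ w Z := fun Z => ENNReal.toReal_nonneg
  set S := ∑ Z ∈ 𝒵, w Z with hS
  have hSnn : 0 ≤ S := sum_nonneg fun Z _ => hwnn Z
  induction n generalizing Y t with
  | zero =>
    have h1 := norm_extend_le hY hK.1
      (NormedSpace.exp ((t : ℂ) • partialGenerator L Λ 𝒵) (embed hX A))
    have h2 := (isDissipative_partialGenerator (Λ := Λ) (𝒵 := 𝒵) hLindblad).norm_exp_apply_le ht
      (embed hX A)
    have h3 := norm_embed_le hX A
    simp only [range_zero, sum_empty, pow_zero, Nat.factorial_zero, Nat.cast_one, div_one, mul_one,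
      zero_add]
    exact h1.trans (mul_le_mul_of_nonneg_left (h2.trans h3) ENNReal.toReal_nonneg)
  | succ n ih =>
    set c := (cbNorm K).toReal * ‖A‖ with hc
    have hcnn : 0 ≤ c := mul_nonneg ENNReal.toReal_nonneg (norm_nonneg A)
    set g := chainWeight w 𝒵 X with hg
    -- The comparison generator omits the terms meeting `Y`. The remaining ones commute with `K`, so
    -- the defect is the sum of `K ∘ L_Z` over the sets `Z` meeting `Y`.
    have key := norm_intertwine_exp_sub_le (a := partialGenerator L Λ 𝒵)
      (b := partialGenerator L Λ (𝒵.filter fun Z => Disjoint Z Y))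
      (k := LinearMap.toContinuousLinearMap (extend hY K))
      (fun s hs B => (isDissipative_partialGenerator hLindblad).norm_exp_apply_le hs B)
      (embed hX A)
      (B := fun s => c * (∑ j ∈ range n, s ^ (j + 1) / ((j + 1).factorial : ℝ) * g (j + 1) Y +
        s ^ (n + 1) / ((n + 1).factorial : ℝ) * S ^ (n + 1)))
      (B' := fun s => c * (∑ j ∈ range n, s ^ j / (j.factorial : ℝ) * g (j + 1) Y +
        s ^ n / (n.factorial : ℝ) * S ^ (n + 1))) (by simp)
      (fun s => ((HasDerivAt.fun_sum fun j _ =>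
        (hasDerivAt_pow_div_factorial j s).mul_const _).add
          ((hasDerivAt_pow_div_factorial n s).mul_const _)).const_mul c)
      (fun s hs => by
        set B := NormedSpace.exp ((s : ℂ) • partialGenerator L Λ 𝒵) (embed hX A) with hB
        have hcomm : LinearMap.toContinuousLinearMap (extend hY K) (partialGenerator L Λ 𝒵 B) -
            partialGenerator L Λ (𝒵.filter fun Z => Disjoint Z Y)
              (LinearMap.toContinuousLinearMap (extend hY K) B) =
            ∑ Z ∈ 𝒵 with ¬ Disjoint Z Y, extend hY K (localTerm L Λ Z B) := by
          simp only [partialGenerator, _root_.sum_apply, map_sum,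
            LinearMap.coe_toContinuousLinearMap']
          rw [sub_eq_iff_eq_add, ← sum_filter_add_sum_filter_not 𝒵 (fun Z => Disjoint Z Y), add_comm]
          congr 1
          refine sum_congr rfl fun Z hZ => ?_
          obtain ⟨hZ𝒵, hZY⟩ := mem_filter.1 hZ
          rw [localTerm_apply (h𝒵 Z hZ𝒵), localTerm_apply (h𝒵 Z hZ𝒵)]
          exact extend_comm hY (h𝒵 Z hZ𝒵) hZY.symm K (L Z) B
        rw [hcomm]
        have hterm : ∀ Z ∈ 𝒵.filter (fun Z => ¬ Disjoint Z Y),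
            ‖extend hY K (localTerm L Λ Z B)‖ ≤ c * (w Z *
              (∑ j ∈ range n, s ^ j / (j.factorial : ℝ) * g j Z +
                s ^ n / (n.factorial : ℝ) * S ^ n)) := by
          intro Z hZ
          obtain ⟨hZ𝒵, hZY⟩ := mem_filter.1 hZ
          -- The `F`-norm does not see `L_∅`, so finiteness of the cb-norm is available for nonempty
          -- sets only.
          have hne : Z.Nonempty := by
            obtain ⟨z, hz, -⟩ := not_disjoint_iff.1 hZY
            exact ⟨z, hz⟩
          -- The induction hypothesis is applied with `L_Z`, which lies in `CB₀(Z)`, in place of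
          -- `K`.
          have h1 := ih (h𝒵 Z hZ𝒵) (K := L Z) ⟨hcb Z hne, (hLindblad Z).map_one⟩ hs
          rw [localTerm_apply (h𝒵 Z hZ𝒵)]
          refine (norm_extend_le hY hK.1 _).trans ?_
          refine (mul_le_mul_of_nonneg_left h1 ENNReal.toReal_nonneg).trans_eq ?_
          rw [hc]
          ring
        refine (norm_sum_le_of_le _ hterm).trans ?_
        rw [← mul_sum]
        refine mul_le_mul_of_nonneg_left ?_ hcnn
        simp only [mul_add, sum_add_distrib]
        refine add_le_add (le_of_eq ?_) ?_
        · simp only [mul_sum]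
          rw [sum_comm]
          refine sum_congr rfl fun j _ => ?_
          rw [hg]
          simp only [chainWeight, mul_sum]
          refine sum_congr rfl fun Z _ => ?_
          ring
        · rw [← sum_mul]
          have h2 : ∑ Z ∈ 𝒵 with ¬ Disjoint Z Y, w Z ≤ S :=
            sum_le_sum_of_subset_of_nonneg (filter_subset _ _) fun Z _ _ => hwnn Z
          refine (mul_le_mul_of_nonneg_right h2 (by positivity)).trans_eq ?_
          ring) ht
    simp only [LinearMap.coe_toContinuousLinearMap'] at key
    have h0 : ‖extend hY K (embed hX A)‖ ≤ c * g 0 Y := by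
      rw [hg]
      simp only [chainWeight]
      split_ifs with hd
      · rw [extend_embed_eq_zero hX hY hd hK.2, norm_zero, mul_zero]
      · rw [mul_one]
        exact (norm_extend_le hY hK.1 _).trans
          (mul_le_mul_of_nonneg_left (norm_embed_le hX A) ENNReal.toReal_nonneg)
    have h1 := (isDissipative_partialGenerator (Λ := Λ) (𝒵 := 𝒵.filter fun Z => Disjoint Z Y)
      hLindblad).norm_exp_apply_le ht (extend hY K (embed hX A))
    have h2 := norm_le_norm_add_norm_sub'
      (extend hY K (NormedSpace.exp ((t : ℂ) • partialGenerator L Λ 𝒵) (embed hX A)))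
      (NormedSpace.exp ((t : ℂ) • partialGenerator L Λ (𝒵.filter fun Z => Disjoint Z Y))
        (extend hY K (embed hX A)))
    refine h2.trans ((add_le_add (h1.trans h0) key).trans_eq ?_)
    rw [sum_range_succ' _ n]
    simp only [pow_zero, Nat.factorial_zero, Nat.cast_one, div_one, one_mul]
    ring

variable [MetricSpace Γ] {F : ℝ → ℝ} {M : ℝ}

/-- Lieb-Robinson bound, where the first `⌈q⌉` orders of the chain expansion vanish. -/
theorem norm_extend_exp_embed_le_expTail [Nonempty Γ] (hF : IsFFunction Γ F)
    (hLindblad : ∀ Z, IsLindblad (L Z))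
    (hcb : ∀ Z : Finset Γ, Z.Nonempty → cbNorm (L Z) < ∞) (h𝒵 : ∀ Z ∈ 𝒵, Z ⊆ Λ) (hM : 0 ≤ M)
    (h : ∀ x y : Γ, ∑ Z ∈ 𝒵 with x ∈ Z ∧ y ∈ Z, (cbNorm (L Z)).toReal ≤ M * F (dist x y))
    (hX : X ⊆ Λ) (A : LocalAlg ι X) {Y : Finset Γ} (hY : Y ⊆ Λ) (hd : Disjoint Y X)
    {K : LocalAlg ι Y →ₗ[ℂ] LocalAlg ι Y} (hK : IsCB0 K) {q : ℝ}
    (hq : ∀ j < ⌈q⌉₊, chainWeight (fun Z => (cbNorm (L Z)).toReal) 𝒵 X j Y = 0)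
    {t : ℝ} (ht : 0 ≤ t) :
    ‖extend hY K (NormedSpace.exp ((t : ℂ) • partialGenerator L Λ 𝒵) (embed hX A))‖ ≤
      (cbNorm K).toReal * ‖A‖ * (expTail (M * convConst Γ F * t) q / convConst Γ F *
        ∑ x ∈ X, ∑ y ∈ Y, F (dist x y)) := by
  have hC := hF.convConst_pos
  set C := convConst Γ F with hCdef
  set w : Finset Γ → ℝ := fun Z => (cbNorm (L Z)).toReal with hw
  have hwnn : ∀ Z, 0 ≤ w Z := fun Z => ENNReal.toReal_nonneg
  set D := ∑ x ∈ X, ∑ y ∈ Y, F (dist x y) with hD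
  have hDnn : 0 ≤ D := sum_nonneg fun x _ => sum_nonneg fun y _ => (hF.apply_dist_pos x y).le
  set S := ∑ Z ∈ 𝒵, w Z with hS
  have hchain : ∀ n, ∑ j ∈ range n, t ^ j / (j.factorial : ℝ) * chainWeight w 𝒵 X j Y ≤
      expTail (M * C * t) q / C * D := by
    intro n
    have h1 := sum_pow_div_factorial_le_expTail (t := M * C * t) (by positivity) q n
    have h2 : ∑ j ∈ range n, t ^ j / (j.factorial : ℝ) * chainWeight w 𝒵 X j Y ≤
        ∑ j ∈ range n, (if j < ⌈q⌉₊ then 0 else (M * C * t) ^ j / (j.factorial : ℝ)) *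
          (D / C) := by
      refine sum_le_sum fun j _ => ?_
      split_ifs with hj
      · rw [hq j hj, mul_zero, zero_mul]
      · rcases j with - | j
        · simp only [chainWeight, if_pos hd, mul_zero]
          positivity
        · have h3 := chainWeight_succ_le (X := X) hF hwnn h𝒵 hM h j Y
          refine (mul_le_mul_of_nonneg_left h3 (by positivity)).trans_eq ?_
          rw [← hCdef, ← hD]
          field_simp
          ring
    refine h2.trans ?_
    rw [← sum_mul]
    refine (mul_le_mul_of_nonneg_right h1 (by positivity)).trans_eq ?_
    ring
  -- The volume-dependent sum `S` enters only through the remainder `(t S)^n / n!`, which vanishes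
  -- as `n → ∞`.
  have hlim : Filter.Tendsto (fun n : ℕ => (cbNorm K).toReal * ‖A‖ *
      (expTail (M * C * t) q / C * D + (t * S) ^ n / (n.factorial : ℝ))) Filter.atTop
      (nhds ((cbNorm K).toReal * ‖A‖ * (expTail (M * C * t) q / C * D + 0))) :=
    ((FloorSemiring.tendsto_pow_div_factorial_atTop (t * S)).const_add _).const_mul _
  rw [add_zero] at hlim
  refine ge_of_tendsto' hlim fun n => ?_
  refine (norm_extend_exp_embed_le hLindblad hcb h𝒵 hX A n hY hK ht).trans ?_
  refine mul_le_mul_of_nonneg_left (add_le_add (hchain n) (le_of_eq ?_))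
    (mul_nonneg ENNReal.toReal_nonneg (norm_nonneg A))
  rw [mul_pow]
  ring

end LiebRobinson

/-! ### Consequences of a finite F-norm -/

section FNorm

open Finset

variable {Γ : Type*} [DecidableEq Γ] {ι : Γ → Type*} [∀ x, Fintype (ι x)]
  [∀ x, DecidableEq (ι x)] [MetricSpace Γ] {F : ℝ → ℝ}
  {L : ∀ Z : Finset Γ, LocalAlg ι Z →ₗ[ℂ] LocalAlg ι Z}

theorem tsum_cbNorm_le_fNorm (hF : IsFFunction Γ F) (x y : Γ) :
    ∑' Z : {Z : Finset Γ // x ∈ Z ∧ y ∈ Z}, cbNorm (L Z) ≤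
      fNorm F L * ENNReal.ofReal (F (dist x y)) := by
  have h0 : ENNReal.ofReal (F (dist x y)) ≠ 0 := by
    simpa using hF.apply_dist_pos x y
  rw [← ENNReal.div_le_iff h0 ENNReal.ofReal_ne_top]
  refine le_sInf fun M hM => ?_
  rw [ENNReal.div_le_iff h0 ENNReal.ofReal_ne_top]
  exact hM x y

theorem cbNorm_lt_top_of_nonempty (hF : IsFFunction Γ F) (hL : fNorm F L < ∞) {Z : Finset Γ}
    (hZ : Z.Nonempty) : cbNorm (L Z) < ∞ := by
  obtain ⟨x, hx⟩ := hZ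
  have h := tsum_cbNorm_le_fNorm (L := L) hF x x
  exact ((ENNReal.le_tsum (f := fun Z : {Z : Finset Γ // x ∈ Z ∧ x ∈ Z} => cbNorm (L Z))
    ⟨Z, hx, hx⟩).trans h).trans_lt (ENNReal.mul_lt_top hL ENNReal.ofReal_lt_top)

theorem sum_cbNorm_le (hF : IsFFunction Γ F) (hL : fNorm F L < ∞) (𝒵 : Finset (Finset Γ))
    (x y : Γ) : ∑ Z ∈ 𝒵 with x ∈ Z ∧ y ∈ Z, (cbNorm (L Z)).toReal ≤
      (fNorm F L).toReal * F (dist x y) := by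
  have h1 : ∑ Z ∈ 𝒵 with x ∈ Z ∧ y ∈ Z, cbNorm (L Z) ≤
      fNorm F L * ENNReal.ofReal (F (dist x y)) := by
    refine le_trans ?_ (tsum_cbNorm_le_fNorm hF x y)
    rw [← sum_subtype_eq_sum_filter (f := fun Z => cbNorm (L Z))]
    exact ENNReal.sum_le_tsum _
  rw [← ENNReal.toReal_sum fun Z hZ =>
    (cbNorm_lt_top_of_nonempty hF hL ⟨x, (mem_filter.1 hZ).2.1⟩).ne]
  have h2 := ENNReal.toReal_mono (ENNReal.mul_lt_top hL ENNReal.ofReal_lt_top).ne h1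
  rwa [ENNReal.toReal_mul, ENNReal.toReal_ofReal (hF.apply_dist_pos x y).le] at h2

end FNorm

/-! ### The error term: derivative in time and limit in the range -/

section RangeError

open Finset Filter Topology

variable {Γ : Type*} [MetricSpace Γ] {F : ℝ → ℝ} {M : ℝ}

theorem rangeError_nonneg (hF : IsFFunction Γ F) (hM : 0 ≤ M) (X Λ : Finset Γ) {t : ℝ} (ht : 0 ≤ t)
    (r R : ℝ) : 0 ≤ rangeError F M X Λ t r R := by
  classical
  have hC := convConst_nonneg Γ F
  have hG := hF.tailSup_nonneg (R / 2)
  have hE := expTail_nonneg (t := M * convConst Γ F * t) (by positivity) (1 + r / R)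
  have hD : ∀ s : Finset Γ, 0 ≤ ∑ x ∈ X, ∑ y ∈ s, F (dist x y) := fun s =>
    sum_nonneg fun x _ => sum_nonneg fun y _ => (hF.apply_dist_pos x y).le
  rw [rangeError]
  exact mul_nonneg (mul_nonneg hM hG) (add_nonneg (by positivity)
    (mul_nonneg (div_nonneg hE (by positivity)) (hD _)))

open scoped Classical in
-- The error is the time primitive of the rate in `sum_norm_localTerm_le`: differentiation lowers
-- the tail index from `1 + r/R` to `r/R`, and the factor `v` cancels the denominator. For `M = 0`
-- the prefactor makes everything zero, so the division by zero is harmless.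
theorem hasDerivAt_rangeError (hC : 0 < convConst Γ F) (X Λ : Finset Γ) {r R : ℝ} (hr : 0 ≤ r)
    (hR : 0 < R) (s : ℝ) :
    HasDerivAt (fun s => rangeError F M X Λ s r R)
      (M * tailSup Γ F (R / 2) * (((inflation X r).ncard : ℝ) +
        expTail (M * convConst Γ F * s) (r / R) / convConst Γ F *
          ∑ x ∈ X, ∑ y ∈ Λ with y ∉ inflation X r, F (dist x y))) s := by
  rcases eq_or_ne M 0 with rfl | hM
  · simpa [rangeError] using hasDerivAt_const s (0 : ℝ)
  · have h1 : HasDerivAt (fun s => expTail (M * convConst Γ F * s) (1 + r / R))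
        (expTail (M * convConst Γ F * s) (r / R) * (M * convConst Γ F)) s := by
      have h2 := (hasDerivAt_id s).const_mul (M * convConst Γ F)
      rw [mul_one] at h2
      exact (hasDerivAt_expTail (k := r / R) (by positivity) (M * convConst Γ F * s)).comp s h2
    have h3 := (((hasDerivAt_id s).mul_const ((inflation X r).ncard : ℝ)).add
      ((h1.div_const (M * convConst Γ F * convConst Γ F)).mul_const
        (∑ x ∈ X, ∑ y ∈ Λ with y ∉ inflation X r, F (dist x y)))).const_mul
          (M * tailSup Γ F (R / 2))
    refine h3.congr_deriv ?_
    congr 2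
    · rw [one_mul]
    · congr 1
      field_simp

theorem rangeError_zero (F : ℝ → ℝ) (M : ℝ) (X Λ : Finset Γ) {r R : ℝ} (hr : 0 ≤ r) (hR : 0 < R) :
    rangeError F M X Λ 0 r R = 0 := by
  rw [rangeError]
  simp only [mul_zero, zero_mul, expTail_zero_add (r / R) (by positivity), zero_div, add_zero]

/-- Replacing the tail by the full exponential bounds the bracket uniformly in `R`, and the
prefactor `G(R/2)` tends to zero. -/
theorem tendsto_rangeError (hF : IsFFunction Γ F) (hG : Tendsto (tailSup Γ F) atTop (𝓝 0))
    (hM : 0 ≤ M) (X Λ : Finset Γ) {t : ℝ} (ht : 0 ≤ t) (r : ℝ) :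
    Tendsto (fun R => rangeError F M X Λ t r R) atTop (𝓝 0) := by
  classical
  have hC := convConst_nonneg Γ F
  set D := ∑ x ∈ X, ∑ y ∈ Λ with y ∉ inflation X r, F (dist x y) with hD
  have hDnn : 0 ≤ D := sum_nonneg fun x _ => sum_nonneg fun y _ => (hF.apply_dist_pos x y).le
  set C := convConst Γ F with hCdef
  set U := t * ((inflation X r).ncard : ℝ) + Real.exp (M * C * t) / (M * C * C) * D with hU
  have hlim : Tendsto (fun R : ℝ => M * tailSup Γ F (R / 2) * U) atTop (𝓝 0) := by
    have h1 := hG.comp (tendsto_id.atTop_div_const (r := (2 : ℝ)) two_pos)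
    simpa using (h1.const_mul M).mul_const U
  refine squeeze_zero (fun R => rangeError_nonneg hF hM X Λ ht r R) (fun R => ?_) hlim
  have hGnn := hF.tailSup_nonneg (R / 2)
  have hE := expTail_le_exp (t := M * C * t) (by positivity) (1 + r / R)
  rw [rangeError, hU, ← hCdef]
  have h2 : expTail (M * C * t) (1 + r / R) / (M * C * C) ≤ Real.exp (M * C * t) / (M * C * C) :=
    div_le_div_of_nonneg_right hE (by positivity)
  refine mul_le_mul_of_nonneg_left (add_le_add le_rfl ?_) (by positivity)
  refine le_trans (le_of_eq ?_) (mul_le_mul_of_nonneg_right h2 hDnn)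
  rw [hD]

end RangeError

/-! ### Comparison of the full and the finite-range dynamics -/

section FiniteRange

open Finset

variable {Γ : Type*} [DecidableEq Γ] {ι : Γ → Type*} [∀ x, Fintype (ι x)]
  [∀ x, DecidableEq (ι x)] [MetricSpace Γ] {F : ℝ → ℝ}
  {L : ∀ Z : Finset Γ, LocalAlg ι Z →ₗ[ℂ] LocalAlg ι Z}

/-- The total strength, on an observable evolved with the finite-range dynamics, of the interaction
terms of diameter larger than `R`. -/
theorem sum_norm_localTerm_le [Nonempty Γ] (hF : IsFFunction Γ F)
    (hLindblad : ∀ Z, IsLindblad (L Z)) (hL : fNorm F L < ∞) {X Λ : Finset Γ} (hX : X ⊆ Λ)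
    (A : LocalAlg ι X) {r R s : ℝ} (hr : 0 ≤ r) (hR : 0 < R) (hs : 0 ≤ s) (U : Finset Γ)
    (hU : ∀ y, y ∈ U ↔ y ∈ Λ ∧ y ∈ inflation X r) :
    ∑ Z ∈ Λ.powerset.filter fun Z : Finset Γ => R < Metric.diam (Z : Set Γ),
      ‖localTerm L Λ Z (NormedSpace.exp ((s : ℂ) • partialGenerator L Λ
        (Λ.powerset.filter fun Z : Finset Γ => Metric.diam (Z : Set Γ) ≤ R)) (embed hX A))‖ ≤
      ‖A‖ * ((fNorm F L).toReal * tailSup Γ F (R / 2) * ((U.card : ℝ) +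
        expTail ((fNorm F L).toReal * convConst Γ F * s) (r / R) / convConst Γ F *
          ∑ x ∈ X, ∑ y ∈ Λ \ U, F (dist x y))) := by
  set M := (fNorm F L).toReal with hM
  have hMnn : 0 ≤ M := ENNReal.toReal_nonneg
  set w : Finset Γ → ℝ := fun Z => (cbNorm (L Z)).toReal with hw
  have hwnn : ∀ Z, 0 ≤ w Z := fun Z => ENNReal.toReal_nonneg
  have hcb : ∀ Z : Finset Γ, Z.Nonempty → cbNorm (L Z) < ∞ := fun Z hZ =>
    cbNorm_lt_top_of_nonempty hF hL hZ
  set 𝒮 := Λ.powerset.filter fun Z : Finset Γ => Metric.diam (Z : Set Γ) ≤ R with h𝒮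
  set ℬ := Λ.powerset.filter fun Z : Finset Γ => R < Metric.diam (Z : Set Γ) with hℬ
  have hsub : ∀ Z ∈ ℬ, Z ⊆ Λ := fun Z hZ => mem_powerset.1 (mem_filter.1 hZ).1
  have hne : ∀ Z ∈ ℬ, Z.Nonempty := by
    intro Z hZ
    rw [nonempty_iff_ne_empty]
    rintro rfl
    have := (mem_filter.1 hZ).2
    simp only [coe_empty, Metric.diam_empty] at this
    linarith
  have hsite : ∀ y : Γ, ∑ Z ∈ ℬ with y ∈ Z, w Z ≤ M * tailSup Γ F (R / 2) := fun y =>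
    sum_diam_gt_le hF hwnn (fun Z hZ => mem_powerset.1 hZ) hMnn (sum_cbNorm_le hF hL _) hR y
  set B := NormedSpace.exp ((s : ℂ) • partialGenerator L Λ 𝒮) (embed hX A) with hB
  set E := expTail (M * convConst Γ F * s) (r / R) / convConst Γ F with hE
  have hEnn : 0 ≤ E := by
    have hC := convConst_nonneg Γ F
    exact div_nonneg (expTail_nonneg (by positivity) _) hC
  set f : Γ → ℝ := fun y => ∑ x ∈ X, F (dist x y) with hf
  have hfnn : ∀ y, 0 ≤ f y := fun y => sum_nonneg fun x _ => (hF.apply_dist_pos x y).le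
  -- Terms meeting `X(r)`: only contractivity is used, and each site carries total weight at most `M
  -- G(R/2)`.
  have hnear : ∑ Z ∈ ℬ with ¬ Disjoint Z U, ‖localTerm L Λ Z B‖ ≤
      ‖A‖ * (M * tailSup Γ F (R / 2) * (U.card : ℝ)) := by
    have h1 : ∀ Z ∈ ℬ.filter (fun Z => ¬ Disjoint Z U), ‖localTerm L Λ Z B‖ ≤ ‖A‖ * w Z := by
      intro Z hZ
      have hZ' := (mem_filter.1 hZ).1
      rw [localTerm_apply (hsub Z hZ'), mul_comm]
      refine (norm_extend_le _ (hcb Z (hne Z hZ')) _).trans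
        (mul_le_mul_of_nonneg_left ?_ (hwnn Z))
      exact ((isDissipative_partialGenerator hLindblad).norm_exp_apply_le hs _).trans
        (norm_embed_le hX A)
    refine (sum_le_sum h1).trans ?_
    rw [← mul_sum]
    refine mul_le_mul_of_nonneg_left ?_ (norm_nonneg A)
    refine (sum_not_disjoint_le hwnn ℬ U).trans ((sum_le_sum fun y _ => hsite y).trans_eq ?_)
    rw [sum_const, nsmul_eq_mul, mul_comm]
  -- Terms away from `X(r)`: the finite-range Lieb-Robinson bound is applied with `L_Z` itself as
  -- the probing map.
  have hfar : ∑ Z ∈ ℬ with Disjoint Z U, ‖localTerm L Λ Z B‖ ≤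
      ‖A‖ * (M * tailSup Γ F (R / 2) * (E * ∑ y ∈ Λ \ U, f y)) := by
    have h1 : ∀ Z ∈ ℬ.filter (fun Z => Disjoint Z U), ‖localTerm L Λ Z B‖ ≤
        ‖A‖ * E * (w Z * ∑ y ∈ Z, f y) := by
      intro Z hZ
      obtain ⟨hZ', hZU⟩ := mem_filter.1 hZ
      have hfarZ : ∀ x ∈ X, ∀ y ∈ Z, r < dist x y := by
        intro x hx y hy
        by_contra hle
        refine disjoint_left.1 hZU hy ((hU y).2 ⟨hsub Z hZ' hy, x, hx, ?_⟩)
        rw [dist_comm]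
        exact not_lt.1 hle
      have hd : Disjoint Z X := disjoint_left.2 fun y hyZ hyX => by
        have := hfarZ y hyX y hyZ
        rw [dist_self] at this
        linarith
      -- If `j < r / R`, then `j` links of diameter at most `R` cannot bridge a distance larger than
      -- `r`.
      have hq : ∀ j < ⌈r / R⌉₊, chainWeight w 𝒮 X j Z = 0 := by
        intro j hj
        rw [Nat.lt_ceil, lt_div_iff₀ hR] at hj
        exact chainWeight_eq_zero (fun Z hZ => (mem_filter.1 hZ).2) j Z fun x hx y hy =>
          hj.trans (hfarZ x hx y hy)
      rw [localTerm_apply (hsub Z hZ')]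
      refine (norm_extend_exp_embed_le_expTail hF hLindblad hcb
        (fun Z hZ => mem_powerset.1 (mem_filter.1 hZ).1) hMnn (sum_cbNorm_le hF hL _) hX A
        (hsub Z hZ') hd ⟨hcb Z (hne Z hZ'), (hLindblad Z).map_one⟩ hq hs).trans_eq ?_
      rw [sum_comm]
      ring
    refine (sum_le_sum h1).trans ?_
    rw [← mul_sum]
    have h2 : ∑ Z ∈ ℬ with Disjoint Z U, w Z * ∑ y ∈ Z, f y ≤
        ∑ y ∈ Λ \ U, (∑ Z ∈ ℬ with y ∈ Z, w Z) * f y := by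
      simp only [sum_mul]
      simp only [sum_filter]
      rw [sum_comm]
      refine sum_le_sum fun Z hZ => ?_
      rw [← sum_filter]
      split_ifs with hd
      · rw [mul_sum]
        refine sum_le_sum_of_subset_of_nonneg (fun y hy => ?_) fun y _ _ =>
          mul_nonneg (hwnn Z) (hfnn y)
        exact mem_filter.2 ⟨mem_sdiff.2 ⟨hsub Z hZ hy, disjoint_left.1 hd hy⟩, hy⟩
      · exact sum_nonneg fun y _ => mul_nonneg (hwnn Z) (hfnn y)
    have h3 : ∑ y ∈ Λ \ U, (∑ Z ∈ ℬ with y ∈ Z, w Z) * f y ≤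
        M * tailSup Γ F (R / 2) * ∑ y ∈ Λ \ U, f y := by
      rw [mul_sum]
      exact sum_le_sum fun y _ => mul_le_mul_of_nonneg_right (hsite y) (hfnn y)
    refine (mul_le_mul_of_nonneg_left (h2.trans h3)
      (mul_nonneg (norm_nonneg A) hEnn)).trans_eq ?_
    ring
  rw [← sum_filter_add_sum_filter_not ℬ (fun Z => Disjoint Z U)]
  refine (add_le_add hfar hnear).trans_eq ?_
  rw [sum_comm (s := X)]
  ring

/-- The error made in replacing the dynamics by the finite-range dynamics. -/
theorem norm_dynamicsRange_sub_dynamics_le [Nonempty Γ] (hF : IsFFunction Γ F)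
    (hLindblad : ∀ Z, IsLindblad (L Z)) (hL : fNorm F L < ∞) {X Λ : Finset Γ} (hX : X ⊆ Λ)
    (A : LocalAlg ι X) {t r R : ℝ} (ht : 0 ≤ t) (hr : 0 ≤ r) (hR : 0 < R) :
    ‖dynamicsRange L Λ R t (embed hX A) - dynamics L Λ t (embed hX A)‖ ≤
      ‖A‖ * rangeError F (fNorm F L).toReal X Λ t r R := by
  classical
  rw [dynamicsRange, dynamics, semigroup, semigroup, toContinuousLinearMap_generator,
    toContinuousLinearMap_generatorRange]
  have hC := hF.convConst_pos
  set U := Λ.filter (· ∈ inflation X r) with hU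
  have hcard : (U.card : ℝ) ≤ ((inflation X r).ncard : ℝ) := by
    rw [← Set.ncard_coe_finset]
    exact Nat.cast_le.2 (Set.ncard_le_ncard (fun y hy => (mem_filter.1 hy).2)
      (hF.finite_inflation X hr))
  have hsdiff : Λ \ U = Λ.filter (· ∉ inflation X r) := by
    ext y
    simp only [hU, mem_sdiff, mem_filter]
    tauto
  -- With `k` the identity, the full dynamics acts last and only contracts. The observable inside
  -- evolves with finite range, as `sum_norm_localTerm_le` requires.
  refine norm_intertwine_exp_sub_le (k := ContinuousLinearMap.id ℂ (LocalAlg ι Λ))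
    (fun s hs B => (isDissipative_partialGenerator hLindblad).norm_exp_apply_le hs B)
    (embed hX A) (B := fun s => ‖A‖ * rangeError F (fNorm F L).toReal X Λ s r R)
    (by simp [rangeError_zero F _ X Λ hr hR])
    (fun s => (hasDerivAt_rangeError hC X Λ hr hR s).const_mul ‖A‖) (fun s hs => ?_) ht
  simp only [ContinuousLinearMap.id_apply]
  set B := NormedSpace.exp ((s : ℂ) • partialGenerator L Λ
    (Λ.powerset.filter fun Z : Finset Γ => Metric.diam (Z : Set Γ) ≤ R)) (embed hX A) with hB
  have hdiff : partialGenerator L Λ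
      (Λ.powerset.filter fun Z : Finset Γ => Metric.diam (Z : Set Γ) ≤ R) B -
        partialGenerator L Λ Λ.powerset B =
      -∑ Z ∈ Λ.powerset.filter fun Z : Finset Γ => R < Metric.diam (Z : Set Γ), localTerm L Λ Z B := by
    simp only [partialGenerator, _root_.sum_apply]
    rw [← sum_filter_add_sum_filter_not Λ.powerset
      (fun Z : Finset Γ => Metric.diam (Z : Set Γ) ≤ R)]
    simp only [not_le]
    abel
  rw [hdiff, norm_neg]
  refine (norm_sum_le _ _).trans ((sum_norm_localTerm_le hF hLindblad hL hX A hr hR hs U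
    (fun y => mem_filter)).trans ?_)
  rw [hsdiff]
  refine mul_le_mul_of_nonneg_left ?_ (norm_nonneg A)
  exact mul_le_mul_of_nonneg_left (add_le_add hcard le_rfl)
    (mul_nonneg ENNReal.toReal_nonneg (hF.tailSup_nonneg _))

/-- The Lieb-Robinson bound of Nachtergaele, Vershynina and Zagrebnov. -/
theorem norm_extend_dynamics_le [Nonempty Γ] (hF : IsFFunction Γ F)
    (hLindblad : ∀ Z, IsLindblad (L Z)) (hL : fNorm F L < ∞) {X Y Λ : Finset Γ}
    (hXY : Disjoint X Y) (hX : X ⊆ Λ) (hY : Y ⊆ Λ) (A : LocalAlg ι X)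
    {K : LocalAlg ι Y →ₗ[ℂ] LocalAlg ι Y} (hK : IsCB0 K) {t : ℝ} (ht : 0 ≤ t) :
    ‖extend hY K (dynamics L Λ t (embed hX A))‖ ≤
      (cbNorm K).toReal * ‖A‖ / convConst Γ F *
        (Real.exp ((fNorm F L).toReal * convConst Γ F * t) - 1) *
          ∑ x ∈ X, ∑ y ∈ Y, F (dist x y) := by
  rw [dynamics, semigroup, toContinuousLinearMap_generator]
  -- Without a range restriction only the zeroth order vanishes, by disjointness; the tail from `1`
  -- is `e^(vt) - 1`.
  refine (norm_extend_exp_embed_le_expTail (q := 1) hF hLindblad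
    (fun Z hZ => cbNorm_lt_top_of_nonempty hF hL hZ) (fun Z hZ => mem_powerset.1 hZ)
    ENNReal.toReal_nonneg (sum_cbNorm_le hF hL _) hX A hY hXY.symm hK ?_ ht).trans_eq ?_
  · intro j hj
    rw [Nat.ceil_one, Nat.lt_one_iff] at hj
    subst hj
    simp [chainWeight, hXY.symm]
  · rw [expTail_one]
    ring

/-- For `R` beyond the diameter of the volume, nothing is truncated. -/
theorem dynamicsRange_eq_dynamics {Λ : Finset Γ} {R : ℝ} (hR : Metric.diam (Λ : Set Γ) ≤ R)
    (t : ℝ) : dynamicsRange L Λ R t = dynamics L Λ t := by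
  rw [dynamicsRange, dynamics, semigroup, semigroup, toContinuousLinearMap_generator,
    toContinuousLinearMap_generatorRange, filter_true_of_mem]
  intro Z hZ
  exact (Metric.diam_mono (coe_subset.2 (mem_powerset.1 hZ)) Λ.finite_toSet.isBounded).trans hR

end FiniteRange

/-! ### The main theorem -/

theorem theorem2p5 {Γ : Type*} [MetricSpace Γ] [Countable Γ] [DecidableEq Γ]
    (F : ℝ → ℝ) (hF : IsFFunction Γ F)
    {ι : Γ → Type*} [∀ x, Fintype (ι x)] [∀ x, DecidableEq (ι x)]
    (L : ∀ Z : Finset Γ, LocalAlg ι Z →ₗ[ℂ] LocalAlg ι Z)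
    (hLindblad : ∀ Z, IsLindblad (L Z))
    (hL : fNorm F L < ∞)
    (X Y : Finset Γ) (hXY : Disjoint X Y)
    (Λ : Finset Γ) (hX : X ⊆ Λ) (hY : Y ⊆ Λ)
    (A : LocalAlg ι X) (K : LocalAlg ι Y →ₗ[ℂ] LocalAlg ι Y) (hK : IsCB0 K) :
    (∀ t r R : ℝ, 0 ≤ t → 0 ≤ r → 0 < R →
      ‖extend hY K (dynamics L Λ t (embed hX A))‖ ≤
        ‖extend hY K (dynamicsRange L Λ R t (embed hX A))‖ +
          (cbNorm K).toReal * ‖A‖ * rangeError F (fNorm F L).toReal X Λ t r R) ∧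
    (∀ κ ν : ℝ, IsRegularSpace Γ κ ν →
      (Summable fun n : ℕ => (1 + (n : ℝ)) ^ ν * F n) →
      ∀ t r : ℝ, 0 ≤ t → 0 ≤ r →
        Filter.Tendsto (fun R : ℝ => rangeError F (fNorm F L).toReal X Λ t r R)
          Filter.atTop (nhds 0) ∧
        Filter.limsup (fun R : ℝ =>
            ‖extend hY K (dynamicsRange L Λ R t (embed hX A))‖ +
              (cbNorm K).toReal * ‖A‖ * rangeError F (fNorm F L).toReal X Λ t r R)
            Filter.atTop ≤
          (cbNorm K).toReal * ‖A‖ / convConst Γ F *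
            (Real.exp ((fNorm F L).toReal * convConst Γ F * t) - 1) *
              ∑ x ∈ X, ∑ y ∈ Y, F (dist x y) ∧
        ‖extend hY K (dynamics L Λ t (embed hX A))‖ ≤
          (cbNorm K).toReal * ‖A‖ / convConst Γ F *
            (Real.exp ((fNorm F L).toReal * convConst Γ F * t) - 1) *
              ∑ x ∈ X, ∑ y ∈ Y, F (dist x y)) := by
  have hM : 0 ≤ (fNorm F L).toReal := ENNReal.toReal_nonneg
  have hextend_zero : IsEmpty Γ → ∀ B, extend hY K B = 0 := by
    intro hΓ B
    have hK0 : K = 0 := eq_zero_of_subsingleton hK.2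
    rw [hK0]
    rfl
  have hbound : ∀ t : ℝ, 0 ≤ t → ‖extend hY K (dynamics L Λ t (embed hX A))‖ ≤
      (cbNorm K).toReal * ‖A‖ / convConst Γ F *
        (Real.exp ((fNorm F L).toReal * convConst Γ F * t) - 1) *
          ∑ x ∈ X, ∑ y ∈ Y, F (dist x y) := by
    intro t ht
    -- Positivity of `C_F` fails for empty `Γ`; there `K = 0` and the estimate is trivial.
    rcases isEmpty_or_nonempty Γ with hΓ | hΓ
    · rw [hextend_zero hΓ, norm_zero, Finset.sum_eq_zero fun x _ => hΓ.elim x, mul_zero]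
    · exact norm_extend_dynamics_le hF hLindblad hL hXY hX hY A hK ht
  refine ⟨fun t r R ht hr hR => ?_, fun κ ν hreg hsum t r ht hr => ?_⟩
  · rcases isEmpty_or_nonempty Γ with hΓ | hΓ
    · rw [hextend_zero hΓ, hextend_zero hΓ, norm_zero, zero_add]
      exact mul_nonneg (mul_nonneg ENNReal.toReal_nonneg (norm_nonneg A))
        (rangeError_nonneg hF hM X Λ ht r R)
    · have h1 := norm_dynamicsRange_sub_dynamics_le hF hLindblad hL hX A ht hr hR
      have h2 := norm_extend_le hY hK.1
        (dynamicsRange L Λ R t (embed hX A) - dynamics L Λ t (embed hX A))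
      rw [map_sub] at h2
      have h3 := norm_le_norm_add_norm_sub (extend hY K (dynamicsRange L Λ R t (embed hX A)))
        (extend hY K (dynamics L Λ t (embed hX A)))
      refine h3.trans (add_le_add le_rfl (h2.trans ?_))
      rw [mul_assoc]
      exact mul_le_mul_of_nonneg_left h1 ENNReal.toReal_nonneg
  · have hE := tendsto_rangeError hF (hF.tendsto_tailSup hreg hsum) hM X Λ ht r
    refine ⟨hE, ?_, hbound t ht⟩
    -- The first summand is constant once `R ≥ diam Λ` and the error vanishes in the limit, so the
    -- limsup is a genuine limit.
    have hlim : Filter.Tendsto (fun R : ℝ =>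
        ‖extend hY K (dynamicsRange L Λ R t (embed hX A))‖ +
          (cbNorm K).toReal * ‖A‖ * rangeError F (fNorm F L).toReal X Λ t r R)
        Filter.atTop (nhds ‖extend hY K (dynamics L Λ t (embed hX A))‖) := by
      have h1 := (hE.const_mul ((cbNorm K).toReal * ‖A‖)).const_add
        ‖extend hY K (dynamics L Λ t (embed hX A))‖
      rw [mul_zero, add_zero] at h1
      refine h1.congr' ?_
      filter_upwards [Filter.eventually_ge_atTop (Metric.diam (Λ : Set Γ))] with R hR
      rw [dynamicsRange_eq_dynamics hR]
    rw [hlim.limsup_eq]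
    exact hbound t ht
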